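/- Let $(W,S)$ be a right-angled Coxeter system of arbitrary (possibly infinite) rank, i.e. $W$ has the presentation with generating set $S$ and relations $(ss')^{m(s,s')}=e$ for all $s,s'\in S$ with $m(s,s')<\infty$, where $m$ is a symmetric matrix over $S$ with entries in $\{1,2,\infty\}$ and $m(s,s')=1$ if and only if $s=s'$. Let $\Gamma$ be its Coxeter graph, with vertex set $S$ and with distinct $s,s'$ adjacent if and only if $m(s,s')<\infty$ (equivalently, if and only if $s$ and $s'$ commute). For a vertex $v$ let $st(v)$ be the set consisting of $v$ and all its neighbours. Suppose that (a) $\Gamma$ is star-connected, i.e. for every vertex $v$ the induced subgraph $\Gamma - st(v)$ is connected (the empty graph counting as connected); (b) $\Gamma$ is triangle-free; (c) $\Gamma$ contains the path $P_4$ on four vertices as a (not necessarily induced) subgraph. Let $Spe(W)$ be the group of automorphisms of $W$ that stabilize the conjugacy class of every $s\in S$, and $Inn(W)$ the group of inner automorphisms of $W$. Then $Spe(W)=Inn(W)$. If in addition $\Gamma$ has the star property, i.e. $st(v)\not\subseteq st(v')$ for all vertices $v\neq v'$, then $W$ is strongly rigid: for any two Coxeter bases $S_1,S_2$ of $W$ there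 is an inner automorphism $\alpha$ of $W$ with $\alpha(S_1)=S_2$. Here a Coxeter basis of $W$ is a subset $T\subseteq W$ such that $W$ has a presentation with generating set $T$ and relations $(tt')^{m'(t,t')}=e$ for all $t,t'\in T$ with $m'(t,t')<\infty$, for some symmetric matrix $m'$ with entries in $\{1,2,\dots,\infty\}$ and $m'(t,t')=1$ if and only if $t=t'$. -/

import Mathlib

namespace SimpleGraph

variable {V : Type*}

/-- The star of a vertex `v`: the set consisting of `v` and all its neighbours. -/
def star (G : SimpleGraph V) (v : V) : Set V :=
  insert v (G.neighborSet v)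

/-- A graph is star-connected if removing the star of any vertex leaves a connected graph
(the graph without vertices is counted as connected). -/
def StarConnected (G : SimpleGraph V) : Prop :=
  ∀ v : V, (G.induce (G.star v)ᶜ).Preconnected

/-- A graph has the star property if no star of a vertex is contained in the star of
another vertex. -/
def StarProperty (G : SimpleGraph V) : Prop :=
  ∀ v v' : V, v ≠ v' → ¬ G.star v ⊆ G.star v'

end SimpleGraph

namespace CoxeterMatrix

variable {B : Type*}

/-- A Coxeter matrix is right-angled if its entries lie in `{1, 2, ∞}`; following Mathlib's
convention the entry `∞` is written as `0`. -/
def IsRightAngled (M : CoxeterMatrix B) : Prop :=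
  ∀ i j : B, M i j = 1 ∨ M i j = 2 ∨ M i j = 0

/-- The underlying graph of the Coxeter graph of `M`, in the convention where distinct `i` and `j`
are adjacent iff `M i j < ∞` (that is, `M i j ≠ 0` in Mathlib's convention). In the right-angled
case every edge carries the label `2`. -/
def graph (M : CoxeterMatrix B) : SimpleGraph B where
  Adj i j := i ≠ j ∧ M i j ≠ 0
  symm := ⟨fun i j h => ⟨h.1.symm, by rw [M.symmetric]; exact h.2⟩⟩
  loopless := ⟨fun _ h => h.1 rfl⟩

end CoxeterMatrix

namespace CoxeterSystem

variable {B W : Type*} [Group W] {M : CoxeterMatrix B}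

/-- `Spe(W)`: the subgroup of those automorphisms of `W` that stabilize the conjugacy class of
every generator of the given Coxeter system. -/
def spe (cs : CoxeterSystem M W) : Subgroup (MulAut W) where
  carrier := {α | ∀ i : B, α '' conjugatesOf (cs.simple i) = conjugatesOf (cs.simple i)}
  one_mem' := fun i => by simp
  mul_mem' := fun {α β} hα hβ i => by
    have h : (α * β : MulAut W) '' conjugatesOf (cs.simple i)
        = α '' (β '' conjugatesOf (cs.simple i)) := by
      rw [Set.image_image]; rfl
    rw [h, hβ i, hα i]
  inv_mem' := fun {α} hα i => by
    have h : (α⁻¹ : MulAut W) '' (α '' conjugatesOf (cs.simple i))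
        = conjugatesOf (cs.simple i) := by
      rw [Set.image_image]; simp
    rwa [hα i] at h

/-- An automorphism lies in `Spe(W)` iff it sends every generator to a conjugate of itself. -/
theorem mem_spe_iff (cs : CoxeterSystem M W) (α : MulAut W) :
    α ∈ cs.spe ↔ ∀ i : B, IsConj (cs.simple i) (α (cs.simple i)) := by
  constructor
  · intro h i
    have h1 : α (cs.simple i) ∈ α '' conjugatesOf (cs.simple i) :=
      ⟨_, mem_conjugatesOf_self, rfl⟩
    rw [h i] at h1
    exact h1
  · intro h i
    ext w
    constructor
    · rintro ⟨u, hu, rfl⟩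
      exact (h i).trans (α.toMonoidHom.map_isConj hu)
    · intro hw
      refine ⟨α⁻¹ w, ?_, by simp⟩
      have h2 : IsConj (α (cs.simple i)) w := (h i).symm.trans hw
      have h3 := (α⁻¹ : MulAut W).toMonoidHom.map_isConj h2
      change IsConj _ _
      simpa using h3

end CoxeterSystem

/-- A subset `S` of a group `W` is a Coxeter basis if `W` has a Coxeter presentation whose
generators are exactly the elements of `S`. -/
def IsCoxeterBasis {W : Type*} [Group W] (S : Set W) : Prop :=
  ∃ (M : CoxeterMatrix S) (cs : CoxeterSystem M W), ∀ s : S, cs.simple s = (s : W)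

/-- A Coxeter group `W` is strongly rigid if any two of its Coxeter bases (of whatever type) are
carried one to the other by an inner automorphism. -/
def IsStronglyRigid (W : Type*) [Group W] : Prop :=
  ∀ S S' : Set W, IsCoxeterBasis S → IsCoxeterBasis S' →
    ∃ α ∈ (MulAut.conj : W →* MulAut W).range, α '' S = S'

/-!
Let `(W, S)` be a right-angled Coxeter system with triangle-free, star-connected graph that has an
edge. The elements of `W` are regarded as chambers, and each reflection `t` (conjugate of a
generator) has a wall, which cuts the set of chambers into two sides. Everything rests on the
cocycle `sep w t : ℤ/2`, which says whether the wall of `t` separates the chambers `1` and `w`; it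
is defined for arbitrary rank by letting `W` act on `W × ℤ/2`. A chamber `u` lies at the wall of `t`
if `u⁻¹ * t * u` is a generator. Two distinct walls cross exactly if the
reflections commute.

The fact specific to walls in Coxeter groups is `ne_zero_of_sep_eq_one`: if two generators do not
commute, then no chamber is separated from `1` by both of their walls. It is read off from
positivity of roots in the canonical linear representation `rootRep`. As this representation is
faithful and congruent to the trivial one modulo `2`, Minkowski's argument also shows that there are
no nontrivial elements of odd order. By induction on the length, centralizers of products of cliques are
determined, hence commuting involutions can be conjugated simultaneously into the subgroup of a
clique (`exists_common_chamber`, `eq_of_commute_involutions`).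

*Special automorphisms are inner* (`exists_eq_conj_of_mem_spe`). Let `α` preserve the conjugacy
classes of the generators, and consider the walls of the reflections `α s`. If `s'` and `s''`
commute with each other, but not with `s`, then the walls of `α s'` and `α s''` cross, and neither
crosses the wall of `α s`; hence they are on the same side of it. Because the graph is
star-connected, all walls of `α s'`, with `s'` not commuting with `s`, are on one side of the wall
of `α s`. In infinite rank it has to be shown that some chamber `c` lies on these preferred sides of
all walls at once. Take an edge `{a, b}`. There are four chambers at both walls of `α a` and `α b`,
one for each choice of sides of these two walls. Any other generator `s` fails to commute with `a`
or with `b`, so these chambers are on the preferred side of the wall of `α s`. Having found `c`, a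
ping-pong argument (`eq_one_of_nested`) shows that `α` is conjugation by `c`.

*Strong rigidity* (`exists_mem_spe_image_eq`). Elements of finite order have order at most two, so
every Coxeter basis `T` is right-angled, and its graph is triangle-free, because this means that any
two distinct commuting involutions generate a self-centralizing subgroup. An element of `T` is an
involution, thus conjugate to a generator or to the product of an edge. In the second case,
comparing centralizers in the two systems shows that one end of the edge has no further neighbours,
against the star property. Comparing abelianizations, `T` contains exactly one conjugate of each
generator, and the resulting bijection extends to an automorphism that preserves the conjugacy
classes of the generators; so it is inner.
-/

/-! ### Homomorphisms on right-angled Coxeter groups -/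

namespace CoxeterMatrix

variable {B : Type*} {M : CoxeterMatrix B}

/-- In the right-angled case a map is liftable as soon as its values are involutions and the
values at commuting generators commute. -/
theorem IsRightAngled.isLiftable (hra : M.IsRightAngled) {G : Type*} [Monoid G] {f : B → G}
    (hsq : ∀ i, f i * f i = 1) (hcomm : ∀ i j, M i j = 2 → Commute (f i) (f j)) :
    M.IsLiftable f := by
  intro i j
  rcases hra i j with h | h | h
  · obtain rfl : i = j := by
      by_contra hne
      exact M.off_diagonal i j hne h
    rw [h, pow_one, hsq]
  · rw [h, (hcomm i j h).mul_pow, pow_two, pow_two, hsq, hsq, one_mul]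
  · rw [h, pow_zero]

end CoxeterMatrix

namespace CoxeterSystem

variable {B W : Type*} [Group W] {M : CoxeterMatrix B} (cs : CoxeterSystem M W)

/-! ### Generators up to conjugacy -/

theorem commute_simple_of_ne_zero (hra : M.IsRightAngled) {i j : B} (h : M i j ≠ 0) :
    Commute (cs.simple i) (cs.simple j) := by
  rcases hra i j with h1 | h2 | h0
  · obtain rfl : i = j := by
      by_contra hne
      exact M.off_diagonal i j hne h1
    exact Commute.refl _
  · have h := cs.simple_mul_simple_pow i j
    rw [h2, pow_two] at h
    have h' := eq_inv_of_mul_eq_one_left h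
    rw [mul_inv_rev, cs.inv_simple, cs.inv_simple] at h'
    exact h'
  · exact absurd h0 h

open Classical in
/-- The homomorphism to `ℤ/2` counting the parity of the number of letters `i` in a word. -/
noncomputable def letterParity (hra : M.IsRightAngled) (i : B) : W →* Multiplicative (ZMod 2) :=
  cs.lift ⟨fun j => Multiplicative.ofAdd (if j = i then 1 else 0), hra.isLiftable
    (fun j => by split_ifs <;> decide) (fun _ _ _ => Commute.all _ _)⟩

open Classical in
theorem letterParity_simple (hra : M.IsRightAngled) (i j : B) :
    cs.letterParity hra i (cs.simple j) = Multiplicative.ofAdd (if j = i then 1 else 0) :=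
  cs.lift_apply_simple _ _

theorem letterParity_simple_self (hra : M.IsRightAngled) (i : B) :
    cs.letterParity hra i (cs.simple i) = Multiplicative.ofAdd 1 := by
  rw [letterParity_simple, if_pos rfl]

theorem letterParity_simple_of_ne (hra : M.IsRightAngled) {i j : B} (h : j ≠ i) :
    cs.letterParity hra i (cs.simple j) = 1 := by
  rw [letterParity_simple, if_neg h, ofAdd_zero]

theorem _root_.IsConj.map_eq_of_comm {G A : Type*} [Group G] [CommGroup A] (f : G →* A) {x y : G}
    (h : IsConj x y) : f x = f y := by
  obtain ⟨c, rfl⟩ := isConj_iff.1 h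
  rw [map_mul, map_mul, map_inv, mul_comm, inv_mul_cancel_left]

theorem ofAdd_one_ne_one : (Multiplicative.ofAdd (1 : ZMod 2)) ≠ 1 := by decide

theorem eq_of_isConj_simple (hra : M.IsRightAngled) {i j : B}
    (h : IsConj (cs.simple i) (cs.simple j)) : i = j := by
  by_contra hne
  have h' := h.map_eq_of_comm (cs.letterParity hra j)
  rw [cs.letterParity_simple_of_ne hra hne, cs.letterParity_simple_self] at h'
  exact ofAdd_one_ne_one h'.symm

theorem simple_injective_of_isRightAngled (hra : M.IsRightAngled) :
    Function.Injective cs.simple :=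
  fun _ _ h => cs.eq_of_isConj_simple hra (h ▸ IsConj.refl _)

theorem simple_ne_one (hra : M.IsRightAngled) (i : B) : cs.simple i ≠ 1 := by
  intro h
  have h' := cs.letterParity_simple_self hra i
  rw [h, map_one] at h'
  exact ofAdd_one_ne_one h'.symm

theorem not_isConj_simple_simple_mul_simple (hra : M.IsRightAngled) {i a b : B} (hab : a ≠ b) :
    ¬ IsConj (cs.simple i) (cs.simple a * cs.simple b) := by
  intro h
  by_cases hi : i = a
  · have h' := h.map_eq_of_comm (cs.letterParity hra b)
    rw [map_mul, cs.letterParity_simple_of_ne hra hab, cs.letterParity_simple_self,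
      cs.letterParity_simple_of_ne hra (hi ▸ hab)] at h'
    exact absurd h' (by decide)
  · have h' := h.map_eq_of_comm (cs.letterParity hra a)
    rw [map_mul, cs.letterParity_simple_of_ne hra hab.symm, cs.letterParity_simple_self,
      cs.letterParity_simple_of_ne hra hi] at h'
    exact absurd h' (by decide)

/-! ### Walls separating two chambers -/

open Classical in
/-- The operation of a generator on signed elements of `W`: it conjugates the element, and flips the
sign precisely when the element is this generator. -/
noncomputable def signedConjSimple (i : B) (p : W × ZMod 2) : W × ZMod 2 :=
  (cs.simple i * p.1 * cs.simple i, p.2 + if p.1 = cs.simple i then 1 else 0)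

theorem signedConjSimple_signedConjSimple (i : B) (p : W × ZMod 2) :
    cs.signedConjSimple i (cs.signedConjSimple i p) = p := by
  classical
  have hp : cs.simple i * p.1 * cs.simple i = cs.simple i ↔ p.1 = cs.simple i := by
    rw [mul_assoc, mul_eq_left, mul_eq_one_iff_eq_inv, cs.inv_simple]
  have h2 : ∀ x y : ZMod 2, x + y + y = x := by decide
  ext
  · simp [signedConjSimple, mul_assoc]
  · change (p.2 + if p.1 = cs.simple i then 1 else 0) +
      (if cs.simple i * p.1 * cs.simple i = cs.simple i then 1 else 0) = p.2
    rw [if_congr hp rfl rfl]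
    exact h2 _ _

theorem signedConjSimple_comm {i j : B} (hc : Commute (cs.simple i) (cs.simple j))
    (p : W × ZMod 2) : cs.signedConjSimple i (cs.signedConjSimple j p) =
      cs.signedConjSimple j (cs.signedConjSimple i p) := by
  classical
  have key : ∀ x y t : W, Commute x y → x * x = 1 → (x * t * x = y ↔ t = y) := by
    intro x y t hxy hx
    have hy : x * y * x = y := by rw [hxy.eq, mul_assoc, hx, mul_one]
    exact ⟨fun h => mul_left_cancel (mul_right_cancel (h.trans hy.symm)), fun h => h ▸ hy⟩
  have h1 : ∀ x y t : W, x * (y * t * y) * x = x * y * t * (y * x) := fun x y t => by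
    simp only [mul_assoc]
  ext
  · simp only [signedConjSimple]
    rw [h1, h1, hc.eq]
  · change (p.2 + if p.1 = cs.simple j then 1 else 0) +
        (if cs.simple j * p.1 * cs.simple j = cs.simple i then 1 else 0) =
      (p.2 + if p.1 = cs.simple i then 1 else 0) +
        (if cs.simple i * p.1 * cs.simple i = cs.simple j then 1 else 0)
    rw [if_congr (key _ _ _ hc (cs.simple_mul_simple_self i)) rfl rfl,
      if_congr (key _ _ _ hc.symm (cs.simple_mul_simple_self j)) rfl rfl]
    exact add_right_comm _ _ _

/-- The action of `W` on signed elements of `W` that extends `signedConjSimple`. -/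
noncomputable def signedConj (hra : M.IsRightAngled) : W →* Function.End (W × ZMod 2) :=
  cs.lift ⟨fun i => cs.signedConjSimple i, hra.isLiftable
    (fun i => funext (cs.signedConjSimple_signedConjSimple i))
    (fun i j hij => funext (cs.signedConjSimple_comm
      (cs.commute_simple_of_ne_zero hra (by rw [hij]; decide))))⟩

theorem signedConj_simple (hra : M.IsRightAngled) (i : B) (p : W × ZMod 2) :
    cs.signedConj hra (cs.simple i) p = cs.signedConjSimple i p := by
  have h : cs.signedConj hra (cs.simple i) = cs.signedConjSimple i := cs.lift_apply_simple _ i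
  rw [h]

theorem signedConj_apply (hra : M.IsRightAngled) (w : W) (t : W) (e : ZMod 2) :
    cs.signedConj hra w (t, e) = (w * t * w⁻¹, e + (cs.signedConj hra w (t, 0)).2) := by
  induction w using cs.simple_induction_left generalizing e with
  | one => simp [map_one, Function.End.one_def]
  | mul_simple_left w i ih =>
    have h : ∀ p, cs.signedConj hra (cs.simple i * w) p =
        cs.signedConj hra (cs.simple i) (cs.signedConj hra w p) := fun p => by
      rw [map_mul]; rfl
    rw [h, h, ih e, ih 0, signedConj_simple, signedConj_simple]
    simp [signedConjSimple, mul_assoc, add_assoc]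

/-- The number modulo 2 of the times that a gallery from the chamber `1` to the chamber `w` crosses
the wall of `t`: for a reflection `t` it is `1` if this wall separates the two chambers, and `0` if
it does not. It is `0` if `t` is not a reflection. -/
noncomputable def sep (hra : M.IsRightAngled) (w t : W) : ZMod 2 :=
  (cs.signedConj hra w⁻¹ (t, 0)).2

theorem sep_mul (hra : M.IsRightAngled) (u v t : W) :
    cs.sep hra (u * v) t = cs.sep hra u t + cs.sep hra v (u⁻¹ * t * u) := by
  have h : cs.signedConj hra (u * v)⁻¹ (t, 0) =
      cs.signedConj hra v⁻¹ (cs.signedConj hra u⁻¹ (t, 0)) := by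
    rw [mul_inv_rev, map_mul]; rfl
  rw [sep, h, cs.signedConj_apply hra u⁻¹ t 0, signedConj_apply]
  simp [sep]

@[simp]
theorem sep_one (hra : M.IsRightAngled) (t : W) : cs.sep hra 1 t = 0 := by
  simp [sep, Function.End.one_def]

open Classical in
theorem sep_simple (hra : M.IsRightAngled) (i : B) (t : W) :
    cs.sep hra (cs.simple i) t = if t = cs.simple i then 1 else 0 := by
  rw [sep, cs.inv_simple, signedConj_simple, signedConjSimple, zero_add]

theorem sep_simple_self (hra : M.IsRightAngled) (i : B) :
    cs.sep hra (cs.simple i) (cs.simple i) = 1 := by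
  rw [sep_simple, if_pos rfl]

theorem sep_simple_of_ne (hra : M.IsRightAngled) {i : B} {t : W} (h : t ≠ cs.simple i) :
    cs.sep hra (cs.simple i) t = 0 := by
  rw [sep_simple, if_neg h]

theorem sep_inv (hra : M.IsRightAngled) (u t : W) :
    cs.sep hra u⁻¹ (u⁻¹ * t * u) = cs.sep hra u t := by
  have h := cs.sep_mul hra u u⁻¹ t
  rw [mul_inv_cancel, sep_one] at h
  have h2 : ∀ x y : ZMod 2, 0 = x + y → y = x := by decide
  exact h2 _ _ h

theorem sep_simple_mul_self (hra : M.IsRightAngled) (i : B) (w : W) :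
    cs.sep hra (cs.simple i * w) (cs.simple i) = 1 + cs.sep hra w (cs.simple i) := by
  rw [sep_mul, sep_simple_self, cs.inv_simple, cs.simple_mul_simple_self, one_mul]

theorem sep_mul_simple_self (hra : M.IsRightAngled) (u : W) (i : B) :
    cs.sep hra (u * cs.simple i) (u * cs.simple i * u⁻¹) =
      cs.sep hra u (u * cs.simple i * u⁻¹) + 1 := by
  rw [sep_mul]
  simp [mul_assoc, sep_simple_self]

theorem sep_mul_simple_of_ne (hra : M.IsRightAngled) {u t : W} {i : B}
    (h : u * cs.simple i * u⁻¹ ≠ t) : cs.sep hra (u * cs.simple i) t = cs.sep hra u t := by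
  rw [sep_mul, sep_simple_of_ne, add_zero]
  rintro h'
  apply h
  rw [← h']
  simp [mul_assoc]

/-- A reflection maps the chamber `1` to the other side of its wall. -/
theorem sep_self (hra : M.IsRightAngled) {t : W} (ht : cs.IsReflection t) :
    cs.sep hra t t = 1 := by
  obtain ⟨u, i, rfl⟩ := ht
  have h : (u * cs.simple i)⁻¹ * (u * cs.simple i * u⁻¹) * (u * cs.simple i) = cs.simple i := by
    simp [mul_assoc]
  have h' : u⁻¹ * (u * cs.simple i * u⁻¹) * u = cs.simple i := by
    simp [mul_assoc]
  rw [sep_mul, sep_mul_simple_self, h, ← cs.sep_inv hra u, h']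
  have h2 : ∀ x : ZMod 2, x + 1 + x = 1 := by decide
  exact h2 _

/-- A reflection exchanges the two sides of its wall. -/
theorem sep_mul_self (hra : M.IsRightAngled) {t : W} (ht : cs.IsReflection t) (w : W) :
    cs.sep hra (t * w) t = 1 + cs.sep hra w t := by
  rw [sep_mul, cs.sep_self hra ht, ht.inv, ht.mul_self, one_mul]

theorem mem_leftInvSeq_of_sep_eq_one (hra : M.IsRightAngled) {ω : List B} {t : W}
    (h : cs.sep hra (cs.wordProd ω) t = 1) : t ∈ cs.leftInvSeq ω := by
  induction ω generalizing t with
  | nil => simp at h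
  | cons i ω ih =>
    rw [cs.wordProd_cons, sep_mul] at h
    rw [leftInvSeq, List.mem_cons, List.mem_map]
    by_cases ht : t = cs.simple i
    · exact Or.inl ht
    · rw [cs.sep_simple_of_ne hra ht, zero_add] at h
      exact Or.inr ⟨_, ih h, by simp [mul_assoc]⟩

theorem length_mul_lt_of_sep_eq_one (hra : M.IsRightAngled) {w t : W} (h : cs.sep hra w t = 1) :
    cs.length (t * w) < cs.length w := by
  obtain ⟨ω, hω, rfl⟩ := cs.exists_isReduced w
  exact (cs.isLeftInversion_of_mem_leftInvSeq hω (cs.mem_leftInvSeq_of_sep_eq_one hra h)).2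

theorem zmod_two_eq_zero_of_ne_one {x : ZMod 2} (h : x ≠ 1) : x = 0 := by
  revert x; decide

theorem exists_sep_simple_eq_one (hra : M.IsRightAngled) {w : W} (hw : w ≠ 1) :
    ∃ i, cs.sep hra w (cs.simple i) = 1 := by
  obtain ⟨i, hi⟩ := cs.exists_leftDescent_of_ne_one hw
  refine ⟨i, ?_⟩
  by_contra h
  have h1 : cs.sep hra (cs.simple i * w) (cs.simple i) = 1 := by
    rw [sep_simple_mul_self, zmod_two_eq_zero_of_ne_one h, add_zero]
  have h2 := cs.length_mul_lt_of_sep_eq_one hra h1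
  rw [cs.simple_mul_simple_cancel_left] at h2
  exact lt_asymm h2 hi

/-- A generator whose wall separates `1` from `w` can be split off from `w` on the left. -/
theorem exists_eq_simple_mul (hra : M.IsRightAngled) {w : W} {i : B}
    (h : cs.sep hra w (cs.simple i) = 1) :
    ∃ v, w = cs.simple i * v ∧ cs.length v < cs.length w ∧ cs.sep hra v (cs.simple i) = 0 := by
  refine ⟨cs.simple i * w, by simp, cs.length_mul_lt_of_sep_eq_one hra h, ?_⟩
  rw [sep_simple_mul_self, h]
  decide

theorem sep_simple_mul_of_commute (hra : M.IsRightAngled) {i : B} {t : W}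
    (h : Commute (cs.simple i) t) (hne : t ≠ cs.simple i) (w : W) :
    cs.sep hra (cs.simple i * w) t = cs.sep hra w t := by
  rw [sep_mul, cs.sep_simple_of_ne hra hne, zero_add, mul_assoc, ← h.eq, inv_mul_cancel_left]

end CoxeterSystem

/-! ### Elements of odd order that are congruent to the identity modulo `2` -/

theorem exists_one_add_pow_eq {R : Type*} [Ring R] (y : R) (n : ℕ) :
    ∃ x : R, (1 + y) ^ n = 1 + n • y + y * y * x := by
  induction n with
  | zero => exact ⟨0, by simp⟩
  | succ n ih =>
    obtain ⟨x, hx⟩ := ih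
    refine ⟨n • 1 + x + x * y, ?_⟩
    rw [pow_succ, hx, succ_nsmul]
    simp only [mul_add, add_mul, mul_one, one_mul, mul_assoc, mul_smul_comm, smul_mul_assoc]
    abel

/-- If `g` is congruent to `1` modulo `2` and has odd order, then it is congruent to `1` modulo
every power of `2`: this is the first step of Minkowski's argument on finite linear groups. -/
theorem exists_eq_one_add_two_pow_smul {R : Type*} [Ring R] [Module.IsTorsionFree ℤ R] {g : R}
    {n : ℕ} (hn : Odd n) (hg : g ^ n = 1) (h : ∃ a : R, g = 1 + (2 : ℤ) • a) (k : ℕ) :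
    ∃ a : R, g = 1 + (2 : ℤ) ^ (k + 1) • a := by
  induction k with
  | zero => simpa using h
  | succ k ih =>
    obtain ⟨a, rfl⟩ := ih
    obtain ⟨x, hx⟩ := exists_one_add_pow_eq ((2 : ℤ) ^ (k + 1) • a) n
    obtain ⟨m, rfl⟩ := hn
    rw [hg, add_assoc, left_eq_add] at hx
    have h0 : (2 : ℤ) ^ (k + 1) • ((2 * m + 1) • a + (2 : ℤ) ^ (k + 1) • (a * a * x)) = 0 := by
      rw [← hx, smul_add, smul_comm]
      congr 1
      simp only [smul_mul_assoc, mul_smul_comm]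
    have h1 := (smul_eq_zero.1 h0).resolve_left (by positivity)
    refine ⟨-(m • a + (2 : ℤ) ^ k • (a * a * x)), ?_⟩
    have h2 : a = (2 : ℤ) • -(m • a + (2 : ℤ) ^ k • (a * a * x)) := by
      rw [smul_neg, ← add_eq_zero_iff_eq_neg, ← h1]
      module
    rw [pow_succ (2 : ℤ) (k + 1), mul_smul, ← h2]

namespace CoxeterSystem

variable {B W : Type*} [Group W] {M : CoxeterMatrix B} (cs : CoxeterSystem M W)

/-! ### The canonical linear representation -/

open Classical in
/-- Minus half the pairing of the simple root `i` with a vector, where distinct simple roots pair to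
`-2` if the generators do not commute, and to `0` if they do. -/
noncomputable def _root_.CoxeterMatrix.halfCoroot (M : CoxeterMatrix B) (i : B) :
    (B →₀ ℤ) →ₗ[ℤ] ℤ :=
  Finsupp.linearCombination ℤ fun j => if i = j then -1 else if M i j = 0 then 1 else 0

/-- Half of the difference of the reflection in the simple root `i` and the identity. -/
noncomputable def _root_.CoxeterMatrix.rootShift (M : CoxeterMatrix B) (i : B) :
    Module.End ℤ (B →₀ ℤ) :=
  (M.halfCoroot i).smulRight (Finsupp.single i 1)

theorem _root_.CoxeterMatrix.halfCoroot_self (M : CoxeterMatrix B) (i : B) :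
    M.halfCoroot i (Finsupp.single i 1) = -1 := by
  simp [CoxeterMatrix.halfCoroot]

theorem _root_.CoxeterMatrix.halfCoroot_of_eq_zero {M : CoxeterMatrix B} {i j : B}
    (h : M i j = 0) : M.halfCoroot i (Finsupp.single j 1) = 1 := by
  have hij : i ≠ j := by
    rintro rfl
    simp at h
  simp [CoxeterMatrix.halfCoroot, hij, h]

theorem _root_.CoxeterMatrix.halfCoroot_of_ne_zero {M : CoxeterMatrix B} {i j : B} (hij : i ≠ j)
    (h : M i j ≠ 0) : M.halfCoroot i (Finsupp.single j 1) = 0 := by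
  simp [CoxeterMatrix.halfCoroot, hij, h]

theorem _root_.CoxeterMatrix.rootShift_mul_rootShift (M : CoxeterMatrix B) (i j : B) :
    M.rootShift i * M.rootShift j = M.halfCoroot i (Finsupp.single j 1) •
      (M.halfCoroot j).smulRight (Finsupp.single i 1) := by
  refine LinearMap.ext fun v => ?_
  have h : ∀ (k : B) (x : B →₀ ℤ), M.rootShift k x = M.halfCoroot k x • Finsupp.single k 1 :=
    fun _ _ => rfl
  change M.rootShift i (M.rootShift j v) = M.halfCoroot i (Finsupp.single j 1) •
    M.halfCoroot j v • Finsupp.single i 1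
  rw [h, h, map_smul, smul_smul, smul_eq_mul, mul_comm]

/-- The canonical representation of a right-angled Coxeter group on the free abelian group on the
simple roots. It is congruent to the trivial representation modulo `2`. -/
noncomputable def rootRep (hra : M.IsRightAngled) : W →* Module.End ℤ (B →₀ ℤ) :=
  cs.lift ⟨fun i => 1 + (2 : ℤ) • M.rootShift i, hra.isLiftable
    (fun i => by
      have h := M.rootShift_mul_rootShift i i
      rw [M.halfCoroot_self] at h
      change _ = (-1 : ℤ) • M.rootShift i at h
      rw [mul_add, mul_one, add_mul, one_mul, smul_mul_smul_comm, h]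
      module)
    (fun i j hij => by
      have hne : i ≠ j := by
        rintro rfl
        simp at hij
      have h1 := M.rootShift_mul_rootShift i j
      have h2 := M.rootShift_mul_rootShift j i
      rw [CoxeterMatrix.halfCoroot_of_ne_zero hne (by omega), zero_smul] at h1
      rw [CoxeterMatrix.halfCoroot_of_ne_zero hne.symm (by rw [M.symmetric]; omega),
        zero_smul] at h2
      have h3 : Commute (M.rootShift i) (M.rootShift j) := h1.trans h2.symm
      exact (Commute.one_left _).add_left
        ((Commute.one_right _).add_right ((h3.smul_left 2).smul_right 2)))⟩

theorem rootRep_simple (hra : M.IsRightAngled) (i : B) (v : B →₀ ℤ) :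
    cs.rootRep hra (cs.simple i) v = v + (2 * M.halfCoroot i v) • Finsupp.single i 1 := by
  have h : cs.rootRep hra (cs.simple i) = 1 + (2 : ℤ) • M.rootShift i := cs.lift_apply_simple _ i
  rw [h, mul_smul]
  rfl

theorem rootRep_simple_self (hra : M.IsRightAngled) (i : B) :
    cs.rootRep hra (cs.simple i) (Finsupp.single i 1) = -Finsupp.single i 1 := by
  rw [rootRep_simple, M.halfCoroot_self]
  module

theorem rootRep_simple_of_eq_zero (hra : M.IsRightAngled) {i j : B} (h : M i j = 0) :
    cs.rootRep hra (cs.simple i) (Finsupp.single j 1) =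
      Finsupp.single j 1 + (2 : ℤ) • Finsupp.single i 1 := by
  rw [rootRep_simple, CoxeterMatrix.halfCoroot_of_eq_zero h, mul_one]

theorem rootRep_simple_of_ne_zero (hra : M.IsRightAngled) {i j : B} (hij : i ≠ j)
    (h : M i j ≠ 0) :
    cs.rootRep hra (cs.simple i) (Finsupp.single j 1) = Finsupp.single j 1 := by
  rw [rootRep_simple, CoxeterMatrix.halfCoroot_of_ne_zero hij h, mul_zero, zero_smul, add_zero]

theorem rootRep_inv_simple_mul (hra : M.IsRightAngled) (i : B) (w : W) (v : B →₀ ℤ) :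
    cs.rootRep hra (cs.simple i * w)⁻¹ v =
      cs.rootRep hra w⁻¹ (cs.rootRep hra (cs.simple i) v) := by
  rw [mul_inv_rev, cs.inv_simple, map_mul]
  rfl

/-- The simultaneous induction behind `rootRep_inv_nonneg`. The second part deals with two
generators that do not commute: if only the wall of the second one separates `1` from `w`, then
`w⁻¹` maps to the positive cone every combination in which the first coefficient is the larger one.
-/ theorem rootRep_inv_nonneg_aux (hra : M.IsRightAngled) (n : ℕ) :
    ∀ w : W, cs.length w = n →
      (∀ i, cs.sep hra w (cs.simple i) = 0 →
        0 ≤ cs.rootRep hra w⁻¹ (Finsupp.single i 1)) ∧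
      (∀ i j, M i j = 0 → cs.sep hra w (cs.simple i) = 0 → cs.sep hra w (cs.simple j) = 1 →
        ∀ a b : ℤ, 0 ≤ b → b ≤ a →
          0 ≤ cs.rootRep hra w⁻¹ (a • Finsupp.single i 1 + b • Finsupp.single j 1)) := by
  induction n using Nat.strong_induction_on with
  | _ n ih =>
    intro w hw
    have hB : ∀ i j, M i j = 0 → cs.sep hra w (cs.simple i) = 0 →
        cs.sep hra w (cs.simple j) = 1 → ∀ a b : ℤ, 0 ≤ b → b ≤ a →
          0 ≤ cs.rootRep hra w⁻¹ (a • Finsupp.single i 1 + b • Finsupp.single j 1) := by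
      intro i j hij hi hj a b hb hab
      obtain ⟨v, rfl, hlt, hv⟩ := cs.exists_eq_simple_mul hra hj
      have hji : M j i = 0 := by rw [M.symmetric]; exact hij
      have e : cs.rootRep hra (cs.simple j) (a • Finsupp.single i 1 + b • Finsupp.single j 1) =
          (2 * a - b) • Finsupp.single j 1 + a • Finsupp.single i 1 := by
        rw [map_add, map_smul, map_smul, cs.rootRep_simple_of_eq_zero hra hji,
          cs.rootRep_simple_self]
        module
      rw [rootRep_inv_simple_mul, e]
      obtain ⟨ihA, ihB⟩ := ih _ (hw ▸ hlt) v rfl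
      by_cases h : cs.sep hra v (cs.simple i) = 1
      · exact ihB j i hji hv h _ _ (by omega) (by omega)
      · rw [map_add, map_smul, map_smul]
        exact add_nonneg (smul_nonneg (by omega) (ihA j hv))
          (smul_nonneg (by omega) (ihA i (zmod_two_eq_zero_of_ne_one h)))
    refine ⟨fun i hi => ?_, hB⟩
    by_cases hw1 : w = 1
    · rw [hw1, inv_one, map_one]
      exact Finsupp.single_nonneg.2 zero_le_one
    · obtain ⟨j, hj⟩ := cs.exists_sep_simple_eq_one hra hw1
      have hji : j ≠ i := by
        rintro rfl
        rw [hi] at hj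
        exact absurd hj (by decide)
      by_cases hM : M i j = 0
      · simpa using hB i j hM hi hj 1 0 le_rfl zero_le_one
      · have hM' : M j i ≠ 0 := by rw [M.symmetric]; exact hM
        obtain ⟨v, rfl, hlt, hv⟩ := cs.exists_eq_simple_mul hra hj
        rw [cs.sep_simple_mul_of_commute hra (cs.commute_simple_of_ne_zero hra hM')
          ((cs.simple_injective_of_isRightAngled hra).ne hji.symm)] at hi
        rw [rootRep_inv_simple_mul, cs.rootRep_simple_of_ne_zero hra hji hM']
        exact (ih _ (hw ▸ hlt) v rfl).1 i hi

/-- If the wall of the generator `i` does not separate the chambers `1` and `w`, then `w⁻¹` maps the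
simple root `i` to a positive root. -/
theorem rootRep_inv_nonneg (hra : M.IsRightAngled) {w : W} {i : B}
    (h : cs.sep hra w (cs.simple i) = 0) : 0 ≤ cs.rootRep hra w⁻¹ (Finsupp.single i 1) :=
  (cs.rootRep_inv_nonneg_aux hra _ w rfl).1 i h

theorem rootRep_inv_nonpos (hra : M.IsRightAngled) {w : W} {i : B}
    (h : cs.sep hra w (cs.simple i) = 1) : cs.rootRep hra w⁻¹ (Finsupp.single i 1) ≤ 0 := by
  obtain ⟨v, rfl, -, hv⟩ := cs.exists_eq_simple_mul hra h
  rw [rootRep_inv_simple_mul, rootRep_simple_self, map_neg, neg_nonpos]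
  exact cs.rootRep_inv_nonneg hra hv

theorem rootRep_injective (hra : M.IsRightAngled) : Function.Injective (cs.rootRep hra) := by
  rw [injective_iff_map_eq_one]
  intro w hw
  by_contra hne
  obtain ⟨i, hi⟩ := cs.exists_sep_simple_eq_one hra (inv_ne_one.2 hne)
  have h := cs.rootRep_inv_nonpos hra hi
  rw [inv_inv, hw] at h
  have h' : (Finsupp.single i 1 : B →₀ ℤ) i ≤ (0 : B →₀ ℤ) i := h i
  simp at h'

theorem rootRep_apply_ne_zero (hra : M.IsRightAngled) (w : W) {v : B →₀ ℤ} (hv : v ≠ 0) :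
    cs.rootRep hra w v ≠ 0 := by
  intro h
  apply hv
  have h1 : cs.rootRep hra w⁻¹ (cs.rootRep hra w v) = v := by
    rw [← Module.End.mul_apply, ← map_mul, inv_mul_cancel, map_one, Module.End.one_apply]
  rw [← h1, h, map_zero]

/-- Two generators whose walls both separate `1` from the same chamber commute: otherwise a positive
combination of their roots would be mapped to a vector that is both positive and negative. -/
theorem ne_zero_of_sep_eq_one (hra : M.IsRightAngled) {w : W} {i j : B}
    (hi : cs.sep hra w (cs.simple i) = 1) (hj : cs.sep hra w (cs.simple j) = 1) : M i j ≠ 0 := by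
  intro hij
  have hji : M j i = 0 := by rw [M.symmetric]; exact hij
  have hne : i ≠ j := by
    rintro rfl
    simp at hij
  have hneg := cs.rootRep_inv_nonpos hra hj
  obtain ⟨v, rfl, -, hv⟩ := cs.exists_eq_simple_mul hra hi
  rw [rootRep_inv_simple_mul, cs.rootRep_simple_of_eq_zero hra hij] at hneg
  have hpos : 0 ≤ cs.rootRep hra v⁻¹ (Finsupp.single j 1 + (2 : ℤ) • Finsupp.single i 1) := by
    by_cases h : cs.sep hra v (cs.simple j) = 1
    · have := (cs.rootRep_inv_nonneg_aux hra _ v rfl).2 i j hij hv h 2 1 (by omega) (by omega)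
      rwa [one_smul, add_comm] at this
    · rw [map_add, map_smul]
      exact add_nonneg (cs.rootRep_inv_nonneg hra (zmod_two_eq_zero_of_ne_one h))
        (smul_nonneg (by omega) (cs.rootRep_inv_nonneg hra hv))
  refine cs.rootRep_apply_ne_zero hra v⁻¹ (fun h0 => ?_) (le_antisymm hneg hpos)
  have := DFunLike.congr_fun h0 j
  simp [hne] at this

theorem commute_of_sep_eq_one (hra : M.IsRightAngled) {w : W} {i j : B}
    (hi : cs.sep hra w (cs.simple i) = 1) (hj : cs.sep hra w (cs.simple j) = 1) :
    Commute (cs.simple i) (cs.simple j) :=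
  cs.commute_simple_of_ne_zero hra (cs.ne_zero_of_sep_eq_one hra hi hj)

theorem commute_simple_iff (hra : M.IsRightAngled) {i j : B} :
    Commute (cs.simple i) (cs.simple j) ↔ M i j ≠ 0 := by
  refine ⟨fun h => ?_, cs.commute_simple_of_ne_zero hra⟩
  by_cases hij : i = j
  · rw [hij, M.diagonal]
    exact one_ne_zero
  · have hne := (cs.simple_injective_of_isRightAngled hra).ne hij
    refine cs.ne_zero_of_sep_eq_one hra (w := cs.simple i * cs.simple j) ?_ ?_
    · rw [sep_simple_mul_self, cs.sep_simple_of_ne hra hne, add_zero]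
    · rw [cs.sep_simple_mul_of_commute hra h hne.symm, sep_simple_self]

theorem exists_rootRep_eq (hra : M.IsRightAngled) (w : W) :
    ∃ a : Module.End ℤ (B →₀ ℤ), cs.rootRep hra w = 1 + (2 : ℤ) • a := by
  induction w using cs.simple_induction_left with
  | one => exact ⟨0, by rw [map_one, smul_zero, add_zero]⟩
  | mul_simple_left w i ih =>
    obtain ⟨a, ha⟩ := ih
    have h : cs.rootRep hra (cs.simple i) = 1 + (2 : ℤ) • M.rootShift i :=
      cs.lift_apply_simple _ i
    refine ⟨a + M.rootShift i + (2 : ℤ) • (M.rootShift i * a), ?_⟩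
    rw [map_mul, h, ha, mul_add, mul_one, add_mul, one_mul, smul_mul_smul_comm]
    module

/-- A right-angled Coxeter group has no nontrivial elements of odd order. -/
theorem eq_one_of_pow_eq_one_of_odd (cs : CoxeterSystem M W) (hra : M.IsRightAngled) {w : W}
    {n : ℕ} (hn : Odd n) (hw : w ^ n = 1) : w = 1 := by
  apply cs.rootRep_injective hra
  rw [map_one]
  refine LinearMap.ext fun v => Finsupp.ext fun i => ?_
  have hg : cs.rootRep hra w ^ n = 1 := by rw [← map_pow, hw, map_one]
  rw [Module.End.one_apply, ← sub_eq_zero]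
  -- the difference of the two coordinates is divisible by every power of `2`
  apply Int.eq_zero_of_abs_lt_dvd (m := 2 ^ ((cs.rootRep hra w v i - v i).natAbs + 1))
  · obtain ⟨a, ha⟩ := exists_eq_one_add_two_pow_smul hn hg (cs.exists_rootRep_eq hra w)
      (cs.rootRep hra w v i - v i).natAbs
    refine ⟨a v i, ?_⟩
    generalize (cs.rootRep hra w v i - v i).natAbs = k at ha
    rw [ha, LinearMap.add_apply, LinearMap.smul_apply, Module.End.one_apply, Finsupp.add_apply,
      Finsupp.smul_apply, smul_eq_mul, add_sub_cancel_left]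
  · rw [Int.abs_eq_natAbs]
    exact_mod_cast Nat.lt_two_pow_self.trans (Nat.pow_lt_pow_right one_lt_two (Nat.lt_succ_self _))

/-! ### Centralizers -/

theorem commute_simple_of_commute_of_sep (hra : M.IsRightAngled) {v : W} {a k : B}
    (hv : Commute v (cs.simple a)) (hk : cs.sep hra v (cs.simple k) = 1) :
    Commute (cs.simple k) (cs.simple a) := by
  by_cases hka : k = a
  · rw [hka]
  by_cases ha : cs.sep hra v (cs.simple a) = 1
  · exact cs.commute_of_sep_eq_one hra hk ha
  -- both walls separate `1` from `v * s a = s a * v`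
  refine cs.commute_of_sep_eq_one hra (w := cs.simple a * v) ?_ ?_
  · rw [← hv.eq, cs.sep_mul_simple_of_ne hra, hk]
    rw [hv.eq, mul_inv_cancel_right]
    exact (cs.simple_injective_of_isRightAngled hra).ne (Ne.symm hka)
  · rw [sep_simple_mul_self, zmod_two_eq_zero_of_ne_one ha, add_zero]

theorem commute_simple_of_commute_mul_of_sep (hra : M.IsRightAngled) {v : W} {a b k : B}
    (hab : a ≠ b) (hc : Commute (cs.simple a) (cs.simple b))
    (hv : Commute v (cs.simple a * cs.simple b)) (hk : cs.sep hra v (cs.simple k) = 1) :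
    Commute (cs.simple k) (cs.simple a) := by
  have hinj := cs.simple_injective_of_isRightAngled hra
  by_cases hka : k = a
  · rw [hka]
  by_cases hkb : k = b
  · rw [hkb]
    exact hc.symm
  by_cases ha : cs.sep hra v (cs.simple a) = 1
  · exact cs.commute_of_sep_eq_one hra hk ha
  have hne : ∀ (u : W) (i : B), k ≠ i → u * cs.simple i * u⁻¹ ≠ cs.simple k := fun u i hi h =>
    hi (cs.eq_of_isConj_simple hra (isConj_iff.2 ⟨u, h⟩)).symm
  -- both walls separate `1` from `v * (s a * s b) = s a * s b * v`
  refine cs.commute_of_sep_eq_one hra (w := cs.simple a * cs.simple b * v) ?_ ?_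
  · rw [← hv.eq, ← mul_assoc, cs.sep_mul_simple_of_ne hra (hne _ _ hkb),
      cs.sep_mul_simple_of_ne hra (hne _ _ hka), hk]
  · rw [mul_assoc, sep_simple_mul_self, cs.sep_simple_mul_of_commute hra hc.symm (hinj.ne hab),
      zmod_two_eq_zero_of_ne_one ha, add_zero]

/-- The walls that separate `1` from an element of the centralizer of a generator are all
orthogonal to the wall of this generator. -/
theorem commute_of_commute_of_sep (hra : M.IsRightAngled) {v r : W} {a : B}
    (hv : Commute v (cs.simple a)) (hr : cs.sep hra v r = 1) : Commute r (cs.simple a) := by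
  induction hn : cs.length v using Nat.strong_induction_on generalizing v r with
  | _ n ih =>
    by_cases hv1 : v = 1
    · rw [hv1, sep_one] at hr
      exact absurd hr (by decide)
    obtain ⟨k, hk⟩ := cs.exists_sep_simple_eq_one hra hv1
    have hka := cs.commute_simple_of_commute_of_sep hra hv hk
    obtain ⟨u, rfl, hlt, -⟩ := cs.exists_eq_simple_mul hra hk
    have hu : Commute u (cs.simple a) := by
      have := hka.inv_left.mul_left hv
      rwa [inv_mul_cancel_left] at this
    by_cases hrk : r = cs.simple k
    · rwa [hrk]
    · rw [sep_mul, cs.sep_simple_of_ne hra hrk, zero_add] at hr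
      have h := ih _ (hn ▸ hlt) hu hr rfl
      have h' := (hka.mul_left h).mul_left hka.inv_left
      simpa [mul_assoc] using h'

/-- Which side of the wall of `r` a chamber at the wall of `t` lies on depends only on the two
walls, if they do not cross. -/
theorem sep_eq_sep_of_conj_eq (hra : M.IsRightAngled) {u u' r : W} {i j : B}
    (h : u * cs.simple i * u⁻¹ = u' * cs.simple j * u'⁻¹)
    (hr : ¬ Commute r (u * cs.simple i * u⁻¹)) : cs.sep hra u r = cs.sep hra u' r := by
  obtain rfl : i = j := cs.eq_of_isConj_simple hra
    ((isConj_iff.2 ⟨u, rfl⟩).trans (h ▸ (isConj_iff.2 ⟨u', rfl⟩).symm))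
  have hv : Commute (u⁻¹ * u') (cs.simple i) := by
    have h' : cs.simple i = u⁻¹ * u' * cs.simple i * (u⁻¹ * u')⁻¹ := by
      have := congrArg (fun x => u⁻¹ * x * u) h
      simpa [mul_assoc] using this
    rw [eq_mul_inv_iff_mul_eq] at h'
    exact h'.symm
  have hs := cs.sep_mul hra u (u⁻¹ * u') r
  rw [mul_inv_cancel_left] at hs
  rw [hs]
  by_cases h1 : cs.sep hra (u⁻¹ * u') (u⁻¹ * r * u) = 1
  · have h2 := cs.commute_of_commute_of_sep hra hv h1
    refine absurd ?_ hr
    have h3 := (Commute.conj_iff u).2 h2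
    simpa [mul_assoc] using h3
  · rw [zmod_two_eq_zero_of_ne_one h1, add_zero]

/-! ### Involutions -/

theorem _root_.CoxeterMatrix.eq_zero_of_cliqueFree (htri : M.graph.CliqueFree 3) {i j k : B}
    (hij : i ≠ j) (hik : i ≠ k) (hjk : j ≠ k) (h1 : M i j ≠ 0) (h2 : M i k ≠ 0) : M j k = 0 := by
  classical
  by_contra h3
  exact htri {i, j, k} (SimpleGraph.is3Clique_triple_iff.2 ⟨⟨hij, h1⟩, ⟨hik, h2⟩, ⟨hjk, h3⟩⟩)

theorem not_commute_of_cliqueFree (hra : M.IsRightAngled) (htri : M.graph.CliqueFree 3)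
    {i j k : B} (hij : i ≠ j) (hik : i ≠ k) (hjk : j ≠ k)
    (h1 : Commute (cs.simple i) (cs.simple j)) (h2 : Commute (cs.simple i) (cs.simple k)) :
    ¬ Commute (cs.simple j) (cs.simple k) := fun h3 =>
  (cs.commute_simple_iff hra).1 h3 (CoxeterMatrix.eq_zero_of_cliqueFree htri hij hik hjk
    ((cs.commute_simple_iff hra).1 h1) ((cs.commute_simple_iff hra).1 h2))

/-- An element that commutes with all generators whose walls separate it from `1` is the product of
a clique. -/
theorem eq_prod_clique_of_commute (hra : M.IsRightAngled) (htri : M.graph.CliqueFree 3) {w : W}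
    (hw : ∀ k, cs.sep hra w (cs.simple k) = 1 → Commute (cs.simple k) w) :
    w = 1 ∨ (∃ a, w = cs.simple a) ∨
      ∃ a b, a ≠ b ∧ Commute (cs.simple a) (cs.simple b) ∧ w = cs.simple a * cs.simple b := by
  induction hn : cs.length w using Nat.strong_induction_on generalizing w with
  | _ n ih =>
    by_cases hw1 : w = 1
    · exact Or.inl hw1
    have hinj := cs.simple_injective_of_isRightAngled hra
    obtain ⟨i, hi⟩ := cs.exists_sep_simple_eq_one hra hw1
    have hiw := hw i hi
    obtain ⟨v, rfl, hlt, hv⟩ := cs.exists_eq_simple_mul hra hi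
    have hiv : Commute (cs.simple i) v := by
      have := (Commute.refl (cs.simple i)).inv_right.mul_right hiw
      rwa [inv_mul_cancel_left] at this
    -- the walls separating `1` from `v` also separate `1` from `s i * v`
    have hkey : ∀ k, cs.sep hra v (cs.simple k) = 1 →
        k ≠ i ∧ Commute (cs.simple i) (cs.simple k) ∧ Commute (cs.simple k) v := by
      intro k hk
      have hki : k ≠ i := by
        rintro rfl
        rw [hv] at hk
        exact absurd hk (by decide)
      have hik : Commute (cs.simple i) (cs.simple k) :=
        (cs.commute_simple_of_commute_of_sep hra hiv.symm hk).symm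
      have hk' : cs.sep hra (cs.simple i * v) (cs.simple k) = 1 := by
        rw [cs.sep_simple_mul_of_commute hra hik (hinj.ne hki), hk]
      have := hik.symm.inv_right.mul_right (hw k hk')
      rw [inv_mul_cancel_left] at this
      exact ⟨hki, hik, this⟩
    rcases ih _ (hn ▸ hlt) (fun k hk => (hkey k hk).2.2) rfl with
      rfl | ⟨a, rfl⟩ | ⟨a, b, hab, hc, rfl⟩
    · exact Or.inr (Or.inl ⟨i, mul_one _⟩)
    · obtain ⟨h1, h2, -⟩ := hkey a (cs.sep_simple_self hra a)
      exact Or.inr (Or.inr ⟨i, a, h1.symm, h2, rfl⟩)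
    · obtain ⟨h1, h2, -⟩ := hkey a (by
        rw [sep_simple_mul_self, cs.sep_simple_of_ne hra (hinj.ne hab), add_zero])
      obtain ⟨h3, h4, -⟩ := hkey b (by
        rw [cs.sep_simple_mul_of_commute hra hc (hinj.ne hab.symm), sep_simple_self])
      exact absurd hc (cs.not_commute_of_cliqueFree hra htri h1.symm h3.symm hab h2 h4)

/-- An involution `y` commuting with `x` can be conjugated by the centralizer of `x` so that it
commutes with all generators whose walls separate it from `1`: a conjugate of minimal length
will do. -/
theorem exists_conj_commute (hra : M.IsRightAngled) {x : W}
    (hx : ∀ v, Commute v x → ∀ k, cs.sep hra v (cs.simple k) = 1 → Commute (cs.simple k) x)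
    {y : W} (hy : y * y = 1) (hyx : Commute y x) :
    ∃ g, Commute g x ∧ Commute (g * y * g⁻¹) x ∧
      ∀ k, cs.sep hra (g * y * g⁻¹) (cs.simple k) = 1 →
        Commute (cs.simple k) (g * y * g⁻¹) := by
  induction hn : cs.length y using Nat.strong_induction_on generalizing y with
  | _ n ih =>
    by_cases hall : ∀ k, cs.sep hra y (cs.simple k) = 1 → Commute (cs.simple k) y
    · exact ⟨1, Commute.one_left x, by simpa using hyx, by simpa using hall⟩
    push Not at hall
    obtain ⟨k, hk, hnc⟩ := hall
    have hkx := hx y hyx k hk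
    have hyinv : y⁻¹ = y := inv_eq_of_mul_eq_one_left hy
    have h1 : cs.sep hra (y * cs.simple k) (cs.simple k) = 1 := by
      rw [cs.sep_mul_simple_of_ne hra, hk]
      intro h
      exact hnc (mul_inv_eq_iff_eq_mul.1 h).symm
    have h2 := cs.length_mul_lt_of_sep_eq_one hra h1
    have h3 := cs.length_mul_lt_of_sep_eq_one hra hk
    rw [← cs.length_inv (cs.simple k * y), mul_inv_rev, hyinv, cs.inv_simple] at h3
    obtain ⟨g, hg1, hg2, hg3⟩ := ih _ (hn ▸ h2.trans h3) (y := cs.simple k * (y * cs.simple k))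
      (by
        simp only [mul_assoc, cs.simple_mul_simple_cancel_left]
        rw [← mul_assoc y y, hy, one_mul, cs.simple_mul_simple_self])
      (hkx.mul_left (hyx.mul_left hkx)) rfl
    have e : g * (cs.simple k * (y * cs.simple k)) * g⁻¹ =
        g * cs.simple k * y * (g * cs.simple k)⁻¹ := by
      simp [mul_assoc]
    rw [e] at hg2 hg3
    exact ⟨g * cs.simple k, hg1.mul_left hkx, hg2, hg3⟩

theorem exists_conj_eq_of_mul_self (hra : M.IsRightAngled) (htri : M.graph.CliqueFree 3) {y : W}
    (hy : y * y = 1) :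
    y = 1 ∨ (∃ a, IsConj y (cs.simple a)) ∨
      ∃ a b, a ≠ b ∧ Commute (cs.simple a) (cs.simple b) ∧
        IsConj y (cs.simple a * cs.simple b) := by
  obtain ⟨g, -, -, hg⟩ := cs.exists_conj_commute hra (x := 1) (fun _ _ _ _ => Commute.one_right _)
    hy (Commute.one_right y)
  rcases cs.eq_prod_clique_of_commute hra htri hg with h | ⟨a, h⟩ | ⟨a, b, hab, hc, h⟩
  · rw [mul_inv_eq_one, mul_eq_left] at h
    exact Or.inl h
  · exact Or.inr (Or.inl ⟨a, isConj_iff.2 ⟨g, h⟩⟩)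
  · exact Or.inr (Or.inr ⟨a, b, hab, hc, isConj_iff.2 ⟨g, h⟩⟩)

theorem exists_conj_eq_of_commute_simple (hra : M.IsRightAngled) (htri : M.graph.CliqueFree 3)
    {y : W} {a : B} (hy : y * y = 1) (hya : Commute y (cs.simple a)) :
    y = 1 ∨ y = cs.simple a ∨ ∃ c, c ≠ a ∧ Commute (cs.simple c) (cs.simple a) ∧
      ∃ g, Commute g (cs.simple a) ∧
        (g * y * g⁻¹ = cs.simple c ∨ g * y * g⁻¹ = cs.simple a * cs.simple c) := by
  have hinj := cs.simple_injective_of_isRightAngled hra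
  obtain ⟨g, hga, hgy, hg⟩ := cs.exists_conj_commute hra
    (fun v hv k hk => cs.commute_simple_of_commute_of_sep hra hv hk) hy hya
  rcases cs.eq_prod_clique_of_commute hra htri hg with h | ⟨c, h⟩ | ⟨c, d, hcd, hc, h⟩
  · rw [mul_inv_eq_one, mul_eq_left] at h
    exact Or.inl h
  · by_cases hca : c = a
    · subst hca
      rw [mul_inv_eq_iff_eq_mul, ← hga.eq] at h
      exact Or.inr (Or.inl (mul_left_cancel h))
    · rw [h] at hgy
      exact Or.inr (Or.inr ⟨c, hca, hgy, g, hga, Or.inl h⟩)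
  · have h1 : Commute (cs.simple c) (cs.simple a) := by
      apply cs.commute_simple_of_commute_of_sep hra hgy
      rw [h, sep_simple_mul_self, cs.sep_simple_of_ne hra (hinj.ne hcd), add_zero]
    have h2 : Commute (cs.simple d) (cs.simple a) := by
      apply cs.commute_simple_of_commute_of_sep hra hgy
      rw [h, cs.sep_simple_mul_of_commute hra hc (hinj.ne hcd.symm), sep_simple_self]
    by_cases hca : c = a
    · exact Or.inr (Or.inr ⟨d, fun hda => hcd (hca.trans hda.symm), h2, g, hga,
        Or.inr (by rw [h, hca])⟩)
    · by_cases hda : d = a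
      · exact Or.inr (Or.inr ⟨c, hca, h1, g, hga, Or.inr (by rw [h, hc.eq, hda])⟩)
      · exact absurd hc (cs.not_commute_of_cliqueFree hra htri (Ne.symm hca) (Ne.symm hda) hcd
          h1.symm h2.symm)

/-- A variant of `eq_prod_clique_of_commute` for elements of the centralizer of an edge. -/
theorem eq_of_sep_simple_eq_one (hra : M.IsRightAngled) (htri : M.graph.CliqueFree 3)
    {a b : B} (hab : a ≠ b) (hc : Commute (cs.simple a) (cs.simple b)) {y : W}
    (hy : ∀ k, cs.sep hra y (cs.simple k) = 1 → Commute (cs.simple k) y ∧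
      Commute (cs.simple k) (cs.simple a) ∧ Commute (cs.simple k) (cs.simple b)) :
    y = 1 ∨ y = cs.simple a ∨ y = cs.simple b ∨ y = cs.simple a * cs.simple b := by
  have hinj := cs.simple_injective_of_isRightAngled hra
  have hmem : ∀ k, cs.sep hra y (cs.simple k) = 1 → k = a ∨ k = b := by
    intro k hk
    by_contra! h
    exact cs.not_commute_of_cliqueFree hra htri h.1 h.2 hab (hy k hk).2.1 (hy k hk).2.2 hc
  rcases cs.eq_prod_clique_of_commute hra htri (fun k hk => (hy k hk).1) with
    h | ⟨c, h⟩ | ⟨c, d, hcd, hc', h⟩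
  · exact Or.inl h
  · rcases hmem c (by rw [h, sep_simple_self]) with rfl | rfl
    · exact Or.inr (Or.inl h)
    · exact Or.inr (Or.inr (Or.inl h))
  · have h1 := hmem c (by
      rw [h, sep_simple_mul_self, cs.sep_simple_of_ne hra (hinj.ne hcd), add_zero])
    have h2 := hmem d (by
      rw [h, cs.sep_simple_mul_of_commute hra hc' (hinj.ne hcd.symm), sep_simple_self])
    right; right; right
    rcases h1 with rfl | rfl <;> rcases h2 with rfl | rfl
    · exact absurd rfl hcd
    · exact h
    · rw [h, hc.eq]
    · exact absurd rfl hcd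

/-- The centralizer of the subgroup generated by an edge is this subgroup. -/
theorem eq_of_commute_of_commute (hra : M.IsRightAngled) (htri : M.graph.CliqueFree 3)
    {a b : B} (hab : a ≠ b) (hc : Commute (cs.simple a) (cs.simple b)) {y : W}
    (hya : Commute y (cs.simple a)) (hyb : Commute y (cs.simple b)) :
    y = 1 ∨ y = cs.simple a ∨ y = cs.simple b ∨ y = cs.simple a * cs.simple b := by
  refine cs.eq_of_sep_simple_eq_one hra htri hab hc fun k hk => ?_
  have h1 := cs.commute_simple_of_commute_of_sep hra hya hk
  have h2 := cs.commute_simple_of_commute_of_sep hra hyb hk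
  by_cases hka : k = a
  · exact ⟨hka ▸ hya.symm, h1, h2⟩
  · by_cases hkb : k = b
    · exact ⟨hkb ▸ hyb.symm, h1, h2⟩
    · exact absurd hc (cs.not_commute_of_cliqueFree hra htri hka hkb hab h1 h2)

theorem exists_conj_eq_of_commute_mul (hra : M.IsRightAngled) (htri : M.graph.CliqueFree 3)
    {a b : B} (hab : a ≠ b) (hc : Commute (cs.simple a) (cs.simple b)) {y : W}
    (hy : y * y = 1) (hyab : Commute y (cs.simple a * cs.simple b)) :
    ∃ g, Commute g (cs.simple a * cs.simple b) ∧
      (g * y * g⁻¹ = 1 ∨ g * y * g⁻¹ = cs.simple a ∨ g * y * g⁻¹ = cs.simple b ∨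
        g * y * g⁻¹ = cs.simple a * cs.simple b) := by
  have key : ∀ v, Commute v (cs.simple a * cs.simple b) → ∀ k,
      cs.sep hra v (cs.simple k) = 1 →
        Commute (cs.simple k) (cs.simple a) ∧ Commute (cs.simple k) (cs.simple b) :=
    fun v hv k hk => ⟨cs.commute_simple_of_commute_mul_of_sep hra hab hc hv hk,
      cs.commute_simple_of_commute_mul_of_sep hra hab.symm hc.symm (hc.eq ▸ hv) hk⟩
  obtain ⟨g, hga, hgy, hg⟩ := cs.exists_conj_commute hra
    (fun v hv k hk => (key v hv k hk).1.mul_right (key v hv k hk).2) hy hyab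
  exact ⟨g, hga,
    cs.eq_of_sep_simple_eq_one hra htri hab hc fun k hk => ⟨hg k hk, key _ hgy k hk⟩⟩

/-- Two distinct commuting involutions generate a self-centralizing subgroup. -/
theorem eq_of_commute_involutions (cs : CoxeterSystem M W) (hra : M.IsRightAngled)
    (htri : M.graph.CliqueFree 3) {x y z : W} (hx : x * x = 1) (hx1 : x ≠ 1) (hy : y * y = 1)
    (hy1 : y ≠ 1) (hxy : x ≠ y) (hc : Commute x y) (hzx : Commute z x) (hzy : Commute z y) :
    z = 1 ∨ z = x ∨ z = y ∨ z = x * y := by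
  have back : ∀ k : W, (k * z * k⁻¹ = 1 ∨ k * z * k⁻¹ = k * x * k⁻¹ ∨ k * z * k⁻¹ = k * y * k⁻¹ ∨
      k * z * k⁻¹ = k * x * k⁻¹ * (k * y * k⁻¹)) → z = 1 ∨ z = x ∨ z = y ∨ z = x * y := by
    intro k h
    simpa only [conj_mul, conj_eq_one_iff, mul_left_inj, mul_right_inj] using h
  rcases cs.exists_conj_eq_of_mul_self hra htri hx with h | ⟨a, h⟩ | ⟨a, b, hab, hcab, h⟩
  · exact absurd h hx1
  · obtain ⟨g, hg⟩ := isConj_iff.1 h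
    have hya : Commute (g * y * g⁻¹) (cs.simple a) := by
      rw [← hg]
      exact (Commute.conj_iff g).2 hc.symm
    rcases cs.exists_conj_eq_of_commute_simple hra htri (y := g * y * g⁻¹)
      (by rw [conj_mul, hy, mul_one, mul_inv_cancel]) hya with h1 | h1 | ⟨c, hca, hcc, k, hka, h1⟩
    · exact absurd (conj_eq_one_iff.1 h1) hy1
    · rw [← hg, mul_left_inj, mul_right_inj] at h1
      exact absurd h1.symm hxy
    have hX : k * g * x * (k * g)⁻¹ = cs.simple a := by
      rw [← mul_inv_cancel_right (cs.simple a) k, ← hka.eq, ← hg]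
      simp only [mul_inv_rev, mul_assoc]
    have hY : k * g * y * (k * g)⁻¹ = k * (g * y * g⁻¹) * k⁻¹ := by
      simp only [mul_inv_rev, mul_assoc]
    rw [← hY] at h1
    apply back (k * g)
    have hzx' := (Commute.conj_iff (k * g)).2 hzx
    have hzy' := (Commute.conj_iff (k * g)).2 hzy
    rw [hX] at hzx' ⊢
    rcases h1 with h1 | h1
    · rw [h1] at hzy' ⊢
      exact cs.eq_of_commute_of_commute hra htri hca.symm hcc.symm hzx' hzy'
    · rw [h1] at hzy' ⊢
      have hzc := hzx'.mul_right hzy'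
      rw [cs.simple_mul_simple_cancel_left] at hzc ⊢
      have := cs.eq_of_commute_of_commute hra htri hca.symm hcc.symm hzx' hzc
      tauto
  · obtain ⟨g, hg⟩ := isConj_iff.1 h
    have hyab : Commute (g * y * g⁻¹) (cs.simple a * cs.simple b) := by
      rw [← hg]
      exact (Commute.conj_iff g).2 hc.symm
    obtain ⟨k, hka, h1⟩ := cs.exists_conj_eq_of_commute_mul hra htri hab hcab (y := g * y * g⁻¹)
      (by rw [conj_mul, hy, mul_one, mul_inv_cancel]) hyab
    have hX : k * g * x * (k * g)⁻¹ = cs.simple a * cs.simple b := by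
      rw [← mul_inv_cancel_right (cs.simple a * cs.simple b) k, ← hka.eq, ← hg]
      simp only [mul_inv_rev, mul_assoc]
    have hY : k * g * y * (k * g)⁻¹ = k * (g * y * g⁻¹) * k⁻¹ := by
      simp only [mul_inv_rev, mul_assoc]
    rw [← hY] at h1
    apply back (k * g)
    have hzx' := (Commute.conj_iff (k * g)).2 hzx
    have hzy' := (Commute.conj_iff (k * g)).2 hzy
    rcases h1 with h1 | h1 | h1 | h1
    · exact absurd (conj_eq_one_iff.1 h1) hy1
    · rw [hX] at hzx' ⊢
      rw [h1] at hzy' ⊢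
      have hzb := hzy'.mul_right hzx'
      rw [cs.simple_mul_simple_cancel_left] at hzb
      rw [hcab.eq, cs.simple_mul_simple_cancel_right, ← hcab.eq]
      have := cs.eq_of_commute_of_commute hra htri hab hcab hzy' hzb
      tauto
    · rw [hX] at hzx' ⊢
      rw [h1] at hzy' ⊢
      have hza := hzx'.mul_right hzy'
      rw [cs.simple_mul_simple_cancel_right] at hza ⊢
      have := cs.eq_of_commute_of_commute hra htri hab hcab hza hzy'
      tauto
    · rw [← hX, mul_left_inj, mul_right_inj] at h1
      exact absurd h1.symm hxy

/-- The walls of two distinct commuting reflections have a chamber in common. -/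
theorem exists_common_chamber (hra : M.IsRightAngled) (htri : M.graph.CliqueFree 3) {t t' : W}
    (ht : cs.IsReflection t) (ht' : cs.IsReflection t') (hne : t ≠ t') (hc : Commute t t') :
    ∃ u a b, a ≠ b ∧ Commute (cs.simple a) (cs.simple b) ∧
      t = u * cs.simple a * u⁻¹ ∧ t' = u * cs.simple b * u⁻¹ := by
  obtain ⟨v, a, rfl⟩ := ht
  have hr : cs.IsReflection (v⁻¹ * t' * v) := by simpa using ht'.conj v⁻¹
  obtain ⟨x, i, hi⟩ := hr
  have hconj : IsConj (cs.simple i) (v⁻¹ * t' * v) := isConj_iff.2 ⟨x, hi.symm⟩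
  have hya : Commute (v⁻¹ * t' * v) (cs.simple a) := by
    have h3 := (Commute.conj_iff v⁻¹).2 hc.symm
    simpa [mul_assoc] using h3
  rcases cs.exists_conj_eq_of_commute_simple hra htri (a := a) (y := v⁻¹ * t' * v)
      (by rw [hi]; simp [mul_assoc]) hya with h | h | ⟨c, hca, hcc, g, hga, h | h⟩
  · rw [h] at hconj
    exact absurd (isConj_one_left.1 hconj) (cs.simple_ne_one hra i)
  · refine absurd ?_ hne
    rw [← h]
    simp [mul_assoc]
  · refine ⟨v * g⁻¹, a, c, hca.symm, hcc.symm, ?_, ?_⟩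
    · have : cs.simple a = g⁻¹ * cs.simple a * g := by
        rw [mul_assoc, ← hga.eq, inv_mul_cancel_left]
      nth_rw 1 [this]
      simp [mul_assoc]
    · rw [← h]
      simp [mul_assoc]
  · refine absurd (hconj.trans (isConj_iff.2 ⟨g, h⟩)) ?_
    exact cs.not_isConj_simple_simple_mul_simple hra hca.symm

/-! ### Disjoint walls -/

/-- If the wall of `r` lies on the side of the chamber `1` of the wall of `t`, and conversely, then
no chamber is separated from `1` by both. The proof folds a gallery along the wall of `r` so that it
stays on the far side of this wall, where it cannot cross the wall of `t`. -/
theorem sep_eq_zero_of_nested (hra : M.IsRightAngled) {r t : W} (hr : cs.IsReflection r)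
    (hrt : ∀ u i, u * cs.simple i * u⁻¹ = r → cs.sep hra u t = 0)
    (htr : ∀ u i, u * cs.simple i * u⁻¹ = t → cs.sep hra u r = 0)
    {w : W} (hw : cs.sep hra w r = 1) : cs.sep hra w t = 0 := by
  have hflip : ∀ x : ZMod 2, x + 1 = 1 → x = 0 := by decide
  have hflip' : ∀ x : ZMod 2, x + 1 = 0 → x = 1 := by decide
  obtain ⟨u, hu, hut⟩ : ∃ u, cs.sep hra u r = 1 ∧ cs.sep hra u t = 0 := by
    obtain ⟨v, i, rfl⟩ := hr
    by_cases h : cs.sep hra v (v * cs.simple i * v⁻¹) = 1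
    · exact ⟨v, h, hrt v i rfl⟩
    · refine ⟨v * cs.simple i, ?_, hrt _ i (by simp [mul_assoc])⟩
      rw [sep_mul_simple_self, zmod_two_eq_zero_of_ne_one h, zero_add]
  have key : ∀ y, (cs.sep hra (u * y) r = 1 → cs.sep hra (u * y) t = 0) ∧
      (cs.sep hra (u * y) r = 0 → cs.sep hra (r * (u * y)) t = 0) := by
    intro y
    induction y using cs.simple_induction_right with
    | one =>
      rw [mul_one]
      exact ⟨fun _ => hut, fun h => absurd (hu.symm.trans h) (by decide)⟩
    | mul_simple_right y i ih =>
      rw [← mul_assoc u]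
      generalize u * y = x at ih
      by_cases hx : x * cs.simple i * x⁻¹ = r
      · have hxr : x * cs.simple i = r * x := mul_inv_eq_iff_eq_mul.1 hx
        have hs : cs.sep hra (x * cs.simple i) r = cs.sep hra x r + 1 := by
          have := cs.sep_mul_simple_self hra x i
          rwa [hx] at this
        rw [hs]
        refine ⟨fun h => hxr ▸ ih.2 (hflip _ h), fun h => ?_⟩
        rw [hxr, ← mul_assoc, hr.mul_self, one_mul]
        exact ih.1 (hflip' _ h)
      · rw [cs.sep_mul_simple_of_ne hra hx]
        constructor
        · intro h
          rw [cs.sep_mul_simple_of_ne hra]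
          · exact ih.1 h
          · intro hxt
            rw [htr x i hxt] at h
            exact absurd h (by decide)
        · intro h
          rw [← mul_assoc, cs.sep_mul_simple_of_ne hra]
          · exact ih.2 h
          · intro hxt
            have h' := htr (r * x) i hxt
            rw [cs.sep_mul_self hra hr, h] at h'
            exact absurd h' (by decide)
  have h := (key (u⁻¹ * w)).1
  rw [mul_inv_cancel_left] at h
  exact h hw

theorem sep_eq_zero_of_commute (hra : M.IsRightAngled) (htri : M.graph.CliqueFree 3) {r t : W}
    (hr : cs.IsReflection r) (ht : cs.IsReflection t) (hne : r ≠ t) (hc : Commute r t) :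
    cs.sep hra r t = 0 := by
  obtain ⟨u, a, b, hab, hcab, rfl, rfl⟩ := cs.exists_common_chamber hra htri hr ht hne hc
  have h1 : cs.sep hra (u * cs.simple a) (u * cs.simple b * u⁻¹) =
      cs.sep hra u (u * cs.simple b * u⁻¹) :=
    cs.sep_mul_simple_of_ne hra hne
  have h2 : (u * cs.simple a)⁻¹ * (u * cs.simple b * u⁻¹) * (u * cs.simple a) =
      u⁻¹ * (u * cs.simple b * u⁻¹) * u := by
    simp only [mul_inv_rev, mul_assoc, inv_mul_cancel_left, inv_mul_cancel, mul_one]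
    rw [← hcab.eq, inv_mul_cancel_left]
  have h3 : ∀ x : ZMod 2, x + x = 0 := by decide
  rw [sep_mul, h1, h2, sep_inv, h3]

/-! ### Automorphisms that preserve the conjugacy classes of generators -/

theorem isReflection_map {α : MulAut W} (hα : α ∈ cs.spe) (i : B) :
    cs.IsReflection (α (cs.simple i)) := by
  obtain ⟨c, hc⟩ := isConj_iff.1 ((cs.mem_spe_iff α).1 hα i)
  exact ⟨c, i, hc.symm⟩

/-- If the walls of the images `α (s i)`, `α (s j)` of any two generators that do not commute lie on
the side of the chamber `1` of each other, then `α` is trivial. Indeed, by induction on the length,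
the walls of the `α (s i)` separate `1` from `α h` whenever those of the `s i` separate `1` from
`h`, so the chambers next to `1` must be separated from it by some of them. -/
theorem eq_one_of_nested (hra : M.IsRightAngled) (htri : M.graph.CliqueFree 3) {α : MulAut W}
    (hα : α ∈ cs.spe)
    (hside : ∀ i j, M i j = 0 → ∀ u k, u * cs.simple k * u⁻¹ = α (cs.simple j) →
      cs.sep hra u (α (cs.simple i)) = 0) : α = 1 := by
  have hinj := cs.simple_injective_of_isRightAngled hra
  have key : ∀ n h, cs.length h = n → ∀ j, cs.sep hra h (cs.simple j) = 0 →
      cs.sep hra (α h) (α (cs.simple j)) = 0 := by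
    intro n
    induction n using Nat.strong_induction_on with
    | _ n ih =>
      intro h hn j hj
      by_cases h1 : h = 1
      · rw [h1, map_one, sep_one]
      obtain ⟨i, hi⟩ := cs.exists_sep_simple_eq_one hra h1
      have hij : i ≠ j := by
        rintro rfl
        exact absurd (hi.symm.trans hj) (by decide)
      obtain ⟨k, rfl, hlt, hk⟩ := cs.exists_eq_simple_mul hra hi
      have hri := cs.isReflection_map hα i
      rw [map_mul]
      by_cases hM : M i j = 0
      · apply cs.sep_eq_zero_of_nested hra hri (hside j i (by rw [M.symmetric]; exact hM))
          (hside i j hM)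
        rw [cs.sep_mul_self hra hri, ih _ (hn ▸ hlt) k rfl i hk, add_zero]
      · have hc := cs.commute_simple_of_ne_zero hra hM
        have hc' : Commute (α (cs.simple i)) (α (cs.simple j)) := hc.map α
        rw [cs.sep_simple_mul_of_commute hra hc (hinj.ne hij.symm)] at hj
        rw [sep_mul, cs.sep_eq_zero_of_commute hra htri hri (cs.isReflection_map hα j)
          (α.injective.ne (hinj.ne hij)) hc', zero_add, mul_assoc, ← hc'.eq, inv_mul_cancel_left]
        exact ih _ (hn ▸ hlt) k rfl j hj
  have hfix : ∀ i, α (cs.simple i) = cs.simple i := by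
    intro i
    have hne : α.symm (cs.simple i) ≠ 1 := by
      rw [ne_eq, EmbeddingLike.map_eq_one_iff]
      exact cs.simple_ne_one hra i
    obtain ⟨j, hj⟩ := cs.exists_sep_simple_eq_one hra hne
    obtain ⟨k, hjk, -, hk⟩ := cs.exists_eq_simple_mul hra hj
    have h1 : cs.sep hra (cs.simple i) (α (cs.simple j)) = 1 := by
      rw [← α.apply_symm_apply (cs.simple i), hjk, map_mul,
        cs.sep_mul_self hra (cs.isReflection_map hα j), key _ k rfl j hk, add_zero]
    have h2 : α (cs.simple j) = cs.simple i := by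
      by_contra h
      rw [cs.sep_simple_of_ne hra h] at h1
      exact absurd h1 (by decide)
    have h3 : j = i := cs.eq_of_isConj_simple hra (h2 ▸ (cs.mem_spe_iff α).1 hα j)
    subst h3
    exact h2
  have h : (α : W →* W) = MonoidHom.id W := cs.ext_simple fun i => hfix i
  exact MulEquiv.ext fun w => DFunLike.congr_fun h w

/-- Star-connectedness puts all walls of the `α (s j)`, where `s j` does not commute with `s i`, on
the same side of the wall of `α (s i)`: walls of commuting reflections have a common chamber. -/
theorem exists_side (hra : M.IsRightAngled) (htri : M.graph.CliqueFree 3)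
    (hstar : M.graph.StarConnected) {α : MulAut W} (hα : α ∈ cs.spe) (i : B) :
    ∃ e : ZMod 2, ∀ j, M i j = 0 → ∀ u k, u * cs.simple k * u⁻¹ = α (cs.simple j) →
      cs.sep hra u (α (cs.simple i)) = e := by
  by_cases hex : ∃ j, M i j = 0
  swap
  · exact ⟨0, fun j hj => absurd ⟨j, hj⟩ hex⟩
  obtain ⟨j₀, hj₀⟩ := hex
  have hmem : ∀ j, j ∈ (M.graph.star i)ᶜ ↔ M i j = 0 := by
    intro j
    have : i = j → M i j ≠ 0 := by
      rintro rfl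
      simp
    simp only [SimpleGraph.star, Set.mem_compl_iff, Set.mem_insert_iff,
      SimpleGraph.mem_neighborSet, CoxeterMatrix.graph, eq_comm (a := j)]
    tauto
  have hnc : ∀ j, M i j = 0 → ¬ Commute (α (cs.simple i)) (α (cs.simple j)) := by
    intro j hj h
    have h' : Commute (cs.simple i) (cs.simple j) := by
      have := h.map α.symm
      simpa using this
    exact (cs.commute_simple_iff hra).1 h' hj
  obtain ⟨u₀, k₀, h₀⟩ := cs.isReflection_map hα j₀
  refine ⟨cs.sep hra u₀ (α (cs.simple i)), fun j hj => ?_⟩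
  obtain ⟨p⟩ := hstar i ⟨j₀, (hmem _).2 hj₀⟩ ⟨j, (hmem _).2 hj⟩
  have key : ∀ (x y : ↥(M.graph.star i)ᶜ) (p : (M.graph.induce (M.graph.star i)ᶜ).Walk x y),
      (∀ u k, u * cs.simple k * u⁻¹ = α (cs.simple x) →
        cs.sep hra u (α (cs.simple i)) = cs.sep hra u₀ (α (cs.simple i))) →
      (∀ u k, u * cs.simple k * u⁻¹ = α (cs.simple y) →
        cs.sep hra u (α (cs.simple i)) = cs.sep hra u₀ (α (cs.simple i))) := by
    intro x y p
    induction p with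
    | nil => exact id
    | @cons x y z hxy p ih =>
      intro hx
      apply ih
      have hxy' : (x : B) ≠ y ∧ M x y ≠ 0 := hxy
      obtain ⟨v, a, b, -, -, ha, hb⟩ := cs.exists_common_chamber hra htri
        (cs.isReflection_map hα x) (cs.isReflection_map hα y)
        (α.injective.ne ((cs.simple_injective_of_isRightAngled hra).ne hxy'.1))
        ((cs.commute_simple_of_ne_zero hra hxy'.2).map α)
      intro u k hu
      rw [← hx v a ha.symm]
      refine cs.sep_eq_sep_of_conj_eq hra (hu.trans hb) ?_
      rw [hu]
      exact hnc y ((hmem y).1 y.2)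
  refine key _ _ p fun u k hu => ?_
  refine cs.sep_eq_sep_of_conj_eq hra (hu.trans h₀) ?_
  rw [hu]
  exact hnc j₀ hj₀

/-- One of the two chambers at a wall is on a prescribed side of this wall. -/
theorem exists_chamber_at_wall (hra : M.IsRightAngled) (u : W) (i : B) (e : ZMod 2) :
    ∃ v, (v = u ∨ v = u * cs.simple i) ∧ cs.sep hra v (u * cs.simple i * u⁻¹) = e ∧
      ∀ t, u * cs.simple i * u⁻¹ ≠ t → cs.sep hra v t = cs.sep hra u t := by
  by_cases h : cs.sep hra u (u * cs.simple i * u⁻¹) = e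
  · exact ⟨u, Or.inl rfl, h, fun _ _ => rfl⟩
  · refine ⟨u * cs.simple i, Or.inr rfl, ?_, fun t ht => cs.sep_mul_simple_of_ne hra ht⟩
    rw [sep_mul_simple_self]
    have h2 : ∀ x y : ZMod 2, x ≠ y → x + 1 = y := by decide
    exact h2 _ _ h

/-- A chamber that is on the side prescribed by `exists_side` of the walls of all `α (s i)` is found
among the four chambers at the walls of two commuting `α (s a)` and `α (s b)`: by triangle-freeness
no further `s i` commutes with both. -/
theorem exists_eq_conj_of_mem_spe (hra : M.IsRightAngled) (htri : M.graph.CliqueFree 3)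
    (hstar : M.graph.StarConnected) {a b : B} (hab : M.graph.Adj a b) {α : MulAut W}
    (hα : α ∈ cs.spe) : ∃ c : W, MulAut.conj c = α := by
  choose e he using cs.exists_side hra htri hstar hα
  have hinj : Function.Injective fun i => α (cs.simple i) :=
    α.injective.comp (cs.simple_injective_of_isRightAngled hra)
  obtain ⟨u, x, y, -, hxy, hx, hy⟩ := cs.exists_common_chamber hra htri (cs.isReflection_map hα a)
    (cs.isReflection_map hα b) (hinj.ne hab.1) ((cs.commute_simple_of_ne_zero hra hab.2).map α)
  obtain ⟨v, hvu, hva, hv⟩ := cs.exists_chamber_at_wall hra u x (e a)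
  have hvy : v * cs.simple y * v⁻¹ = α (cs.simple b) := by
    rcases hvu with rfl | rfl
    · exact hy.symm
    · rw [hy, mul_inv_rev, cs.inv_simple, mul_assoc u, hxy.eq]
      simp [mul_assoc]
  obtain ⟨c, -, hcb, hc⟩ := cs.exists_chamber_at_wall hra v y (e b)
  rw [← hx] at hva hv
  rw [hvy] at hcb hc
  have hce : ∀ j, cs.sep hra c (α (cs.simple j)) = e j := by
    intro j
    by_cases hja : j = a
    · rw [hja, hc _ (hinj.ne hab.1.symm), hva]
    by_cases hjb : j = b
    · rw [hjb, hcb]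
    rw [hc _ (hinj.ne (Ne.symm hjb)), hv _ (hinj.ne (Ne.symm hja))]
    by_cases hM : M j a = 0
    · exact he j a hM u x hx.symm
    · refine he j b ?_ u y hy.symm
      by_contra hM'
      exact absurd hab.2 (not_not.2 (
        CoxeterMatrix.eq_zero_of_cliqueFree htri hja hjb hab.1 hM hM'))
  have hβ : MulAut.conj c⁻¹ * α = 1 := by
    apply cs.eq_one_of_nested hra htri
    · refine cs.spe.mul_mem ((cs.mem_spe_iff _).2 fun i => isConj_iff.2 ⟨c⁻¹, rfl⟩) hα
    · intro i j hij v k hv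
      have h1 : c * v * cs.simple k * (c * v)⁻¹ = α (cs.simple j) := by
        change v * cs.simple k * v⁻¹ = c⁻¹ * α (cs.simple j) * c⁻¹⁻¹ at hv
        rw [mul_inv_rev, mul_assoc c, mul_assoc c, ← mul_assoc (v * _), hv]
        simp [mul_assoc]
      have h2 := he i j hij _ _ h1
      rw [sep_mul, hce] at h2
      change cs.sep hra v (c⁻¹ * α (cs.simple i) * c⁻¹⁻¹) = 0
      rw [inv_inv]
      exact left_eq_add.1 h2.symm
  refine ⟨c, ?_⟩
  rw [map_inv, inv_mul_eq_one] at hβ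
  exact hβ

theorem spe_eq_range_conj (hra : M.IsRightAngled) (htri : M.graph.CliqueFree 3)
    (hstar : M.graph.StarConnected) {a b : B} (hab : M.graph.Adj a b) :
    cs.spe = (MulAut.conj : W →* MulAut W).range := by
  ext α
  constructor
  · exact fun hα => cs.exists_eq_conj_of_mem_spe hra htri hstar hab hα
  · rintro ⟨c, rfl⟩
    exact (cs.mem_spe_iff _).2 fun i => isConj_iff.2 ⟨c, rfl⟩

/-! ### Coxeter bases -/

/-- Elements of finite order in a right-angled Coxeter group have order at most `2`: the kernel of
the abelianization contains no involutions, and there are no elements of odd order. -/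
theorem sq_eq_one_of_pow_eq_one (cs : CoxeterSystem M W) (hra : M.IsRightAngled)
    (htri : M.graph.CliqueFree 3) {w : W} {n : ℕ} (hn : n ≠ 0) (hw : w ^ n = 1) : w ^ 2 = 1 := by
  by_contra h
  have hfin : IsOfFinOrder (w ^ 2) := by
    refine (isOfFinOrder_iff_pow_eq_one.2 ⟨n, Nat.pos_of_ne_zero hn, hw⟩).pow
  obtain ⟨p, hp, hdvd⟩ := Nat.exists_prime_and_dvd (mt orderOf_eq_one_iff.1 h)
  have hord := orderOf_pow_orderOf_div hfin.orderOf_pos.ne' hdvd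
  generalize orderOf (w ^ 2) / p = m at hord
  have hx1 : (w ^ 2) ^ m ≠ 1 := by
    intro h1
    rw [h1, orderOf_one] at hord
    exact hp.one_lt.ne hord
  have hxp : ((w ^ 2) ^ m) ^ p = 1 := hord ▸ pow_orderOf_eq_one _
  rcases hp.eq_two_or_odd' with rfl | hodd
  · have hker : ∀ i, cs.letterParity hra i ((w ^ 2) ^ m) = 1 := by
      intro i
      have h2 : ∀ x : Multiplicative (ZMod 2), x ^ 2 = 1 := by decide
      rw [map_pow, map_pow, h2, one_pow]
    rw [pow_two ((w ^ 2) ^ m)] at hxp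
    rcases cs.exists_conj_eq_of_mul_self hra htri hxp with h1 | ⟨a, h1⟩ | ⟨a, b, hab, -, h1⟩
    · exact hx1 h1
    · have h2 := h1.map_eq_of_comm (cs.letterParity hra a)
      rw [hker, letterParity_simple_self] at h2
      exact ofAdd_one_ne_one h2.symm
    · have h2 := h1.map_eq_of_comm (cs.letterParity hra a)
      rw [hker, map_mul, letterParity_simple_self, cs.letterParity_simple_of_ne hra hab.symm,
        mul_one] at h2
      exact ofAdd_one_ne_one h2.symm
  · exact hx1 (cs.eq_one_of_pow_eq_one_of_odd hra hodd hxp)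

open Classical in
/-- The right-angled matrix obtained from a Coxeter matrix by replacing all finite entries off the
diagonal by `2`. -/
noncomputable def _root_.CoxeterMatrix.toRightAngled (M : CoxeterMatrix B) : CoxeterMatrix B where
  M := Matrix.of fun i j => if i = j then 1 else if M i j = 0 then 0 else 2
  isSymm := by
    ext i j
    simp [eq_comm (a := i), M.symmetric i j]
  diagonal i := by simp
  off_diagonal i j hij := by
    simp only [Matrix.of_apply, if_neg hij]
    split_ifs <;> decide

theorem _root_.CoxeterMatrix.toRightAngled_of_eq_zero {M : CoxeterMatrix B} {i j : B}
    (h : M i j = 0) : M.toRightAngled i j = 0 := by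
  have hij : i ≠ j := by
    rintro rfl
    simp at h
  classical
  change (if i = j then 1 else if M i j = 0 then 0 else 2) = 0
  rw [if_neg hij, if_pos h]

theorem _root_.CoxeterMatrix.toRightAngled_of_ne_zero {M : CoxeterMatrix B} {i j : B} (hij : i ≠ j)
    (h : M i j ≠ 0) : M.toRightAngled i j = 2 := by
  classical
  change (if i = j then 1 else if M i j = 0 then 0 else 2) = 2
  rw [if_neg hij, if_neg h]

theorem _root_.CoxeterMatrix.isRightAngled_toRightAngled (M : CoxeterMatrix B) :
    M.toRightAngled.IsRightAngled := by
  intro i j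
  by_cases hij : i = j
  · rw [hij]
    exact Or.inl (M.toRightAngled.diagonal j)
  by_cases h : M i j = 0
  · exact Or.inr (Or.inr (CoxeterMatrix.toRightAngled_of_eq_zero h))
  · exact Or.inr (Or.inl (CoxeterMatrix.toRightAngled_of_ne_zero hij h))

/-- In a group in which elements of finite order have order at most `2`, every Coxeter system with
distinct generators is right-angled in the sense that the group also has the presentation in which
the finite entries off the diagonal are replaced by `2`. -/
theorem exists_system_toRightAngled (htor : ∀ (w : W) (n : ℕ), n ≠ 0 → w ^ n = 1 → w ^ 2 = 1)
    (hinj : Function.Injective cs.simple) :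
    ∃ cs' : CoxeterSystem M.toRightAngled W, ∀ i, cs'.simple i = cs.simple i := by
  have hf : M.IsLiftable M.toRightAngled.simple := by
    intro i j
    by_cases hij : i = j
    · rw [hij, M.diagonal, pow_one]
      exact M.toRightAngled.toCoxeterSystem.simple_mul_simple_self j
    by_cases h : M i j = 0
    · rw [h, pow_zero]
    have h1 := cs.simple_mul_simple_pow i j
    have h2 := htor _ _ h h1
    -- an odd exponent would identify the two generators
    have heven : Even (M i j) := by
      by_contra hodd
      obtain ⟨m, hm⟩ := Nat.not_even_iff_odd.1 hodd
      rw [hm, pow_succ, pow_mul, h2, one_pow, one_mul, mul_eq_one_iff_eq_inv, cs.inv_simple] at h1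
      exact hij (hinj h1)
    obtain ⟨m, hm⟩ := heven.two_dvd
    have h3 := M.toRightAngled.toCoxeterSystem.simple_mul_simple_pow i j
    rw [CoxeterMatrix.toRightAngled_of_ne_zero hij h] at h3
    rw [hm, pow_mul]
    exact (congrArg (· ^ m) h3).trans (one_pow m)
  have hg : M.toRightAngled.IsLiftable cs.simple :=
    M.isRightAngled_toRightAngled.isLiftable cs.simple_mul_simple_self fun i j hij => by
      have hne : i ≠ j := by
        rintro rfl
        simp at hij
      have h : M i j ≠ 0 := by
        intro h
        rw [CoxeterMatrix.toRightAngled_of_eq_zero h] at hij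
        exact absurd hij (by decide)
      have h2 := htor _ _ h (cs.simple_mul_simple_pow i j)
      rw [pow_two] at h2
      have h' := eq_inv_of_mul_eq_one_left h2
      rwa [mul_inv_rev, cs.inv_simple, cs.inv_simple] at h'
  let f : W →* M.toRightAngled.Group := cs.lift ⟨_, hf⟩
  let g : M.toRightAngled.Group →* W := M.toRightAngled.toCoxeterSystem.lift ⟨_, hg⟩
  have hfs : ∀ i, f (cs.simple i) = M.toRightAngled.simple i := fun i => cs.lift_apply_simple hf i
  have hgs : ∀ i, g (M.toRightAngled.simple i) = cs.simple i := fun i =>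
    M.toRightAngled.toCoxeterSystem.lift_apply_simple hg i
  have hgf : g.comp f = MonoidHom.id W := cs.ext_simple fun i => by
    rw [MonoidHom.comp_apply, hfs, hgs, MonoidHom.id_apply]
  have hfg : f.comp g = MonoidHom.id _ := M.toRightAngled.toCoxeterSystem.ext_simple fun i => by
    change f (g (M.toRightAngled.simple i)) = M.toRightAngled.simple i
    rw [hgs, hfs]
  exact ⟨⟨f.toMulEquiv g hgf hfg⟩, hgs⟩

theorem exists_rightAngled_system_of_isCoxeterBasis (cs : CoxeterSystem M W)
    (hra : M.IsRightAngled) (htri : M.graph.CliqueFree 3) {T : Set W} (hT : IsCoxeterBasis T) :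
    ∃ (M' : CoxeterMatrix T) (cs' : CoxeterSystem M' W), M'.IsRightAngled ∧
      ∀ t : T, cs'.simple t = t := by
  obtain ⟨N, ct, hct⟩ := hT
  obtain ⟨cs', hcs'⟩ := ct.exists_system_toRightAngled
    (fun w n hn hw => cs.sq_eq_one_of_pow_eq_one hra htri hn hw)
    (fun t t' h => Subtype.ext (by rwa [hct, hct] at h))
  exact ⟨_, cs', N.isRightAngled_toRightAngled, fun t => (hcs' t).trans (hct t)⟩

variable {B' : Type*} {M' : CoxeterMatrix B'} (cs' : CoxeterSystem M' W)

/-- Triangle-freeness does not depend on the right-angled Coxeter system: it says that two distinct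
commuting involutions generate a self-centralizing subgroup. -/
theorem cliqueFree_three (cs : CoxeterSystem M W) (cs' : CoxeterSystem M' W)
    (hra : M.IsRightAngled) (htri : M.graph.CliqueFree 3) (hra' : M'.IsRightAngled) :
    M'.graph.CliqueFree 3 := by
  classical
  intro s hs
  obtain ⟨x, y, z, hxy, hxz, hyz, -⟩ := SimpleGraph.is3Clique_iff.1 hs
  have hinj := cs'.simple_injective_of_isRightAngled hra'
  have hp := cs'.letterParity_simple_self hra' z
  have hpx := cs'.letterParity_simple_of_ne hra' hxz.1
  have hpy := cs'.letterParity_simple_of_ne hra' hyz.1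
  rcases cs.eq_of_commute_involutions hra htri (cs'.simple_mul_simple_self x)
      (cs'.simple_ne_one hra' x) (cs'.simple_mul_simple_self y) (cs'.simple_ne_one hra' y)
      (hinj.ne hxy.1) (cs'.commute_simple_of_ne_zero hra' hxy.2)
      (cs'.commute_simple_of_ne_zero hra' hxz.2).symm
      (cs'.commute_simple_of_ne_zero hra' hyz.2).symm with h | h | h | h
  · exact cs'.simple_ne_one hra' z h
  · exact hxz.1 (hinj h).symm
  · exact hyz.1 (hinj h).symm
  · rw [h, map_mul, hpx, hpy, one_mul] at hp
    exact ofAdd_one_ne_one hp.symm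

theorem commute_simple_of_isConj (hra : M.IsRightAngled) (htri : M.graph.CliqueFree 3) {x y : W}
    {i j : B} (hx : IsConj x (cs.simple i)) (hy : IsConj y (cs.simple j)) (hc : Commute x y) :
    Commute (cs.simple i) (cs.simple j) := by
  by_cases hxy : x = y
  · subst hxy
    rw [cs.eq_of_isConj_simple hra (hx.symm.trans hy)]
  obtain ⟨c, hc1⟩ := isConj_iff.1 hx.symm
  obtain ⟨d, hd⟩ := isConj_iff.1 hy.symm
  obtain ⟨u, a, b, -, hab, hxa, hyb⟩ := cs.exists_common_chamber hra htri ⟨c, i, hc1.symm⟩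
    ⟨d, j, hd.symm⟩ hxy hc
  have h1 : i = a := cs.eq_of_isConj_simple hra
    (hx.symm.trans (hxa ▸ (isConj_iff.2 ⟨u, rfl⟩).symm))
  have h2 : j = b := cs.eq_of_isConj_simple hra
    (hy.symm.trans (hyb ▸ (isConj_iff.2 ⟨u, rfl⟩).symm))
  rwa [h1, h2]

/-- If conjugation maps the edge `a`, `b` of one system to the pair `t * r`, `r` for an edge
`t`, `r` of another one, then `b` is the only neighbour of `a`. -/
theorem star_subset_star_of_conj_eq (hra : M.IsRightAngled) (hra' : M'.IsRightAngled)
    (htri' : M'.graph.CliqueFree 3) {a b : B} (hab : M.graph.Adj a b) {t r : B'} (htr : t ≠ r)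
    (hc : Commute (cs'.simple t) (cs'.simple r)) {k : W}
    (hka : k * cs.simple a * k⁻¹ = cs'.simple t * cs'.simple r)
    (hkb : k * cs.simple b * k⁻¹ = cs'.simple r) : M.graph.star a ⊆ M.graph.star b := by
  have hkab : k * (cs.simple a * cs.simple b) * k⁻¹ = cs'.simple t := by
    rw [← conj_mul, hka, hkb, cs'.simple_mul_simple_cancel_right]
  intro c hcmem
  rcases hcmem with rfl | hac
  · exact Or.inr hab.symm
  left
  have hcc := cs.commute_simple_of_ne_zero hra hac.2
  obtain ⟨g, -, hg⟩ := cs'.exists_conj_eq_of_commute_mul hra' htri' htr hc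
    (y := k * cs.simple c * k⁻¹) (by simp [mul_assoc])
    (by rw [← hka]; exact (Commute.conj_iff k).2 hcc.symm)
  have hconj : IsConj (cs.simple c) (g * (k * cs.simple c * k⁻¹) * g⁻¹) :=
    (isConj_iff.2 ⟨k, rfl⟩).trans (isConj_iff.2 ⟨g, rfl⟩)
  have hk : ∀ x : W, IsConj (k * x * k⁻¹) x := fun x => (isConj_iff.2 ⟨k, rfl⟩).symm
  rcases hg with h | h | h | h
  · rw [h] at hconj
    exact absurd (isConj_one_left.1 hconj) (cs.simple_ne_one hra c)
  · rw [h, ← hkab] at hconj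
    exact absurd (hconj.trans (hk _)) (cs.not_isConj_simple_simple_mul_simple hra hab.1)
  · rw [h, ← hkb] at hconj
    exact cs.eq_of_isConj_simple hra (hconj.trans (hk _))
  · rw [h, ← hka] at hconj
    exact absurd (cs.eq_of_isConj_simple hra (hconj.trans (hk _))).symm hac.1

/-- With the star property, every generator of another right-angled system is a reflection. If it
were conjugate to the product of an edge `a`, `b`, then the centralizers would show that `a` or `b`
is a vertex of degree one. -/
theorem exists_isConj_simple (hra : M.IsRightAngled) (htri : M.graph.CliqueFree 3)
    (hsp : M.graph.StarProperty) (hra' : M'.IsRightAngled) (t : B') :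
    ∃ i, IsConj (cs'.simple t) (cs.simple i) := by
  have htri' := cs.cliqueFree_three cs' hra htri hra'
  rcases cs.exists_conj_eq_of_mul_self hra htri (cs'.simple_mul_simple_self t) with
    h | h | ⟨a, b, hab, hc, h⟩
  · exact absurd h (cs'.simple_ne_one hra' t)
  · exact h
  exfalso
  have hadj : M.graph.Adj a b := ⟨hab, (cs.commute_simple_iff hra).1 hc⟩
  obtain ⟨g, hg⟩ := isConj_iff.1 h.symm
  have ht : g * cs.simple a * g⁻¹ * (g * cs.simple b * g⁻¹) = cs'.simple t := by
    rw [conj_mul, hg]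
  have hat : Commute (g * cs.simple a * g⁻¹) (cs'.simple t) := by
    rw [← hg]
    exact (Commute.conj_iff g).2 ((Commute.refl _).mul_right hc)
  rcases cs'.exists_conj_eq_of_commute_simple hra' htri' (y := g * cs.simple a * g⁻¹)
      (by simp [mul_assoc]) hat with h1 | h1 | ⟨r, hrt, hcr, k, hkt, h1⟩
  · exact cs.simple_ne_one hra a (conj_eq_one_iff.1 h1)
  · rw [h1, mul_eq_left] at ht
    exact cs.simple_ne_one hra b (conj_eq_one_iff.1 ht)
  have hsplit : ∀ x : W, k * (g * x * g⁻¹) * k⁻¹ = k * g * x * (k * g)⁻¹ := fun x => by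
    simp only [mul_inv_rev, mul_assoc]
  have hprod : k * g * cs.simple a * (k * g)⁻¹ * (k * g * cs.simple b * (k * g)⁻¹) =
      cs'.simple t := by
    rw [← hsplit, ← hsplit, conj_mul, ht, hkt.eq, mul_inv_cancel_right]
  rw [hsplit] at h1
  rcases h1 with h1 | h1
  · refine hsp b a hab.symm (cs.star_subset_star_of_conj_eq cs' hra hra' htri' hadj.symm hrt.symm
      hcr.symm (k := k * g) ?_ h1)
    rw [h1] at hprod
    rw [hcr.symm.eq, ← hprod, cs'.simple_mul_simple_cancel_left]
  · refine hsp a b hab (cs.star_subset_star_of_conj_eq cs' hra hra' htri' hadj hrt.symm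
      hcr.symm (k := k * g) h1 ?_)
    rw [h1, mul_assoc, mul_eq_left] at hprod
    rw [mul_eq_one_iff_inv_eq, cs'.inv_simple] at hprod
    exact hprod.symm

/-- With the star property, any other right-angled system is the image of the given one under an
automorphism that preserves the conjugacy classes of the generators. -/
theorem exists_mem_spe_image_eq (hra : M.IsRightAngled) (htri : M.graph.CliqueFree 3)
    (hsp : M.graph.StarProperty) (hra' : M'.IsRightAngled) :
    ∃ α ∈ cs.spe, α '' Set.range cs.simple = Set.range cs'.simple := by
  have htri' := cs.cliqueFree_three cs' hra htri hra'
  choose e he using cs.exists_isConj_simple cs' hra htri hsp hra'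
  have hinj : Function.Injective e := fun t t' h =>
    cs'.eq_of_isConj_simple hra' ((he t).trans (h ▸ (he t').symm))
  have hsurj : Function.Surjective e := by
    intro i
    by_contra! hi
    have h : cs.letterParity hra i = 1 := cs'.ext_simple fun t => by
      rw [(he t).map_eq_of_comm, cs.letterParity_simple_of_ne hra (hi t), MonoidHom.one_apply]
    have h' := cs.letterParity_simple_self hra i
    rw [h] at h'
    exact ofAdd_one_ne_one h'.symm
  let E : B' ≃ B := Equiv.ofBijective e ⟨hinj, hsurj⟩
  have hE : ∀ i, IsConj (cs.simple i) (cs'.simple (E.symm i)) := fun i => by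
    have := (he (E.symm i)).symm
    rwa [show e (E.symm i) = i from E.apply_symm_apply i] at this
  have hf : M.IsLiftable fun i => cs'.simple (E.symm i) :=
    hra.isLiftable (fun i => cs'.simple_mul_simple_self _) fun i j hij =>
      cs'.commute_simple_of_isConj hra' htri' (hE i) (hE j)
        (cs.commute_simple_of_ne_zero hra (by rw [hij]; decide))
  have hg : M'.IsLiftable fun t => cs.simple (E t) :=
    hra'.isLiftable (fun t => cs.simple_mul_simple_self _) fun t t' h =>
      cs.commute_simple_of_isConj hra htri (he t) (he t')
        (cs'.commute_simple_of_ne_zero hra' (by rw [h]; decide))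
  let f : W →* W := cs.lift ⟨_, hf⟩
  let g : W →* W := cs'.lift ⟨_, hg⟩
  have hfs : ∀ i, f (cs.simple i) = cs'.simple (E.symm i) := cs.lift_apply_simple hf
  have hgs : ∀ t, g (cs'.simple t) = cs.simple (E t) := cs'.lift_apply_simple hg
  have hgf : g.comp f = MonoidHom.id W := cs.ext_simple fun i => by
    rw [MonoidHom.comp_apply, hfs, hgs, E.apply_symm_apply, MonoidHom.id_apply]
  have hfg : f.comp g = MonoidHom.id W := cs'.ext_simple fun t => by
    rw [MonoidHom.comp_apply, hgs, hfs, E.symm_apply_apply, MonoidHom.id_apply]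
  have hα : ∀ i, (f.toMulEquiv g hgf hfg : MulAut W) (cs.simple i) = cs'.simple (E.symm i) := hfs
  refine ⟨f.toMulEquiv g hgf hfg, (cs.mem_spe_iff _).2 fun i => ?_, ?_⟩
  · rw [hα]
    exact hE i
  · rw [← Set.range_comp]
    have : (f.toMulEquiv g hgf hfg : MulAut W) ∘ cs.simple = cs'.simple ∘ E.symm := funext hα
    rw [this, E.symm.surjective.range_comp]

end CoxeterSystem

theorem mainTheorem1 {B W : Type*} [Group W] (M : CoxeterMatrix B) (cs : CoxeterSystem M W)
    (hra : M.IsRightAngled)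
    (hstar : M.graph.StarConnected)
    (htri : M.graph.CliqueFree 3)
    (hP4 : (SimpleGraph.pathGraph 4).IsContained M.graph) :
    cs.spe = (MulAut.conj : W →* MulAut W).range ∧
      (M.graph.StarProperty → IsStronglyRigid W) := by
  -- of the path, only one edge is needed
  obtain ⟨φ⟩ := hP4
  have hadj : (SimpleGraph.pathGraph 4).Adj 0 1 := by
    rw [SimpleGraph.pathGraph_adj]
    exact Or.inl rfl
  have hspe := cs.spe_eq_range_conj hra htri hstar (φ.toHom.map_adj hadj)
  refine ⟨hspe, fun hsp => ?_⟩
  have key : ∀ T : Set W, IsCoxeterBasis T →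
      ∃ c : W, MulAut.conj c '' Set.range cs.simple = T := by
    intro T hT
    obtain ⟨M', cs', hra', hcs'⟩ := cs.exists_rightAngled_system_of_isCoxeterBasis hra htri hT
    obtain ⟨α, hα, hαT⟩ := cs.exists_mem_spe_image_eq cs' hra htri hsp hra'
    rw [hspe] at hα
    obtain ⟨c, rfl⟩ := hα
    refine ⟨c, hαT.trans ?_⟩
    rw [funext hcs', Subtype.range_coe]
  intro S S' hS hS'
  obtain ⟨c, rfl⟩ := key S hS
  obtain ⟨d, rfl⟩ := key S' hS'
  refine ⟨MulAut.conj (d * c⁻¹), ⟨_, rfl⟩, ?_⟩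
  rw [Set.image_image]
  refine Set.image_congr fun w _ => ?_
  rw [map_mul, map_inv, MulAut.mul_apply, MulAut.inv_apply_self]
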